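/- Let $d,n\ge 1$. Decompose $(\mathbb C^d)^{\otimes n}=\bigoplus_{\mathbf n\in Y_n}\mathcal W_{\mathbf n}$, where $Y_n$ is the set of Young indices $\mathbf n=(n_1\ge\dots\ge n_d\ge 0)\in\mathbb Z^d$ with $\sum_i n_i=n$, and $\mathcal W_{\mathbf n}$ is the sum of all irreducible $\mathrm{SU}(d)$-subrepresentations of $(\mathbb C^d)^{\otimes n}$ (under $g\mapsto g^{\otimes n}$) with highest weight $\mathbf n$. Let $P_{\mathbf n}$ be the orthogonal projection onto $\mathcal W_{\mathbf n}$. For $\delta\ge 0$ and $\mathbf k\in\mathbb Z^d$ put, with the Euclidean norm $\|\cdot\|$, $$P_{\mathbf k}^{\delta,n}=\sum_{\mathbf n\in Y_n:\ \|\mathbf n-\mathbf k\|\le n\delta}P_{\mathbf n},\qquad M_{\mathbf k}^{\delta,n}=\frac{1}{C_{1,d}(n\delta)}P_{\mathbf k}^{\delta,n},\qquad C_{1,d}(x)=\#\Big\{\mathbf k\in\mathbb Z^d:\ \|\mathbf k\|\le x,\ \sum_i k_i=0\Big\}.$$ The code $(\mathbf E^{\delta,n},\mathbf D^{\delta,n})$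 has as its data set $Y_{\delta,n}$ the set of all $\mathbf k\in\mathbb Z^d$ with $\sum_i k_i=n$ for which some $\mathbf n\in Y_n$ satisfies $\|\mathbf n-\mathbf k\|\le n\delta$. Its encoder is $$\mathbf E_{\mathbf k}^{\delta,n}(\rho)=\sqrt{M_{\mathbf k}^{\delta,n}}\,\rho\,\sqrt{M_{\mathbf k}^{\delta,n}},$$ regarded as an operator on $\mathcal H_{\mathbf k}^{\delta,n}=\bigoplus_{\mathbf n\in Y_n:\ \|\mathbf n-\mathbf k\|\le n\delta}\mathcal W_{\mathbf n}$, and its decoder $\mathbf D_{\mathbf k}^{\delta,n}$ is the embedding of $\mathcal H_{\mathbf k}^{\delta,n}$ into $(\mathbb C^d)^{\otimes n}$. For a discrete probability $p$ on the density operators of $\mathbb C^d$, the average error of a code $(\mathbf E,\mathbf D)$ with data set $\Omega$ is $$\epsilon_{n,p}(\mathbf E,\mathbf D)=\sum_{\vec\rho_n=\rho_1\otimes\cdots\otimes\rho_n}p(\rho_1)\cdots p(\rho_n)\sum_{\omega\in\Omega}\operatorname{Tr}\mathbf E_\omega(\vec\rho_n)\; b^2\!\left(\vec\rho_n,\ \mathbf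 D_\omega\!\left(\frac{\mathbf E_\omega(\vec\rho_n)}{\operatorname{Tr}\mathbf E_\omega(\vec\rho_n)}\right)\right),\qquad b(\rho,\sigma)=\sqrt{1-\operatorname{Tr}|\sqrt\rho\sqrt\sigma|},$$ where terms with $\operatorname{Tr}\mathbf E_\omega(\vec\rho_n)=0$ count as $0$. Let $d=2$, let $\{|e_1\rangle,|e_2\rangle\}$ be an orthonormal basis of $\mathbb C^2$, and let $p$ be a probability on the density operators of $\mathbb C^2$ whose support is exactly $\{|e_1\rangle\langle e_1|,|e_2\rangle\langle e_2|\}$. Then for every sequence $\{\delta_n\}$ of nonnegative reals with $|\delta_n|<1$, the error $\epsilon_{n,p}(\mathbf E^{\delta_n,n},\mathbf D^{\delta_n,n})$ is positive for all sufficiently large $n$, and $$\lim_{n\to\infty}\frac{-1}{n}\log\epsilon_{n,p}(\mathbf E^{\delta_n,n},\mathbf D^{\delta_n,n})=0 .$$ -/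

import Mathlib

noncomputable section

namespace QCode

/-! ### Hilbert spaces, density operators, Bures distance -/

/-- The single-system space `ℂ^d`. -/
abbrev Sys (d : ℕ) : Type := EuclideanSpace ℂ (Fin d)

/-- The tensor power `(ℂ^d)^{⊗n}` in coordinates: the basis vector indexed by `x : Fin n → Fin d`
is `e_{x 0} ⊗ ⋯ ⊗ e_{x (n-1)}`. -/
abbrev SysPow (d n : ℕ) : Type := EuclideanSpace ℂ (Fin n → Fin d)

/-- Linear operators on a (finite-dimensional) Hilbert space. -/
abbrev Op (H : Type) [NormedAddCommGroup H] [InnerProductSpace ℂ H] : Type := H →L[ℂ] H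

section General

variable {H : Type} [NormedAddCommGroup H] [InnerProductSpace ℂ H]

/-- The trace of an operator. -/
def tr (A : Op H) : ℂ := LinearMap.trace ℂ H (A : H →ₗ[ℂ] H)

/-- The rank-one operator `|v⟩⟨v|`. -/
def ketbra (v : H) : Op H := InnerProductSpace.rankOne ℂ v v

variable (H) in
/-- Density operators: positive operators of trace one. -/
def DensityOp : Type := {ρ : Op H // ρ.IsPositive ∧ tr ρ = 1}

/-- The Bures distance `b(ρ, σ) = √(1 - Tr |√ρ √σ|)`. -/
def bures [CompleteSpace H] (ρ σ : Op H) : ℝ :=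
  Real.sqrt (1 - (tr (CFC.abs (CFC.sqrt ρ * CFC.sqrt σ))).re)

end General

/-! ### Tensor products of operators -/

/-- The operator `A 0 ⊗ ⋯ ⊗ A (n-1)` on `(ℂ^d)^{⊗n}`; its `(x, y)` matrix entry is the product of
the matrix entries `⟨e_{x k}, A k e_{y k}⟩`. -/
def tensorOp {d n : ℕ} (A : Fin n → Op (Sys d)) : Op (SysPow d n) :=
  Matrix.toEuclideanCLM (𝕜 := ℂ)
    (Matrix.of fun x y : Fin n → Fin d =>
      ∏ k, (A k (EuclideanSpace.single (y k) (1 : ℂ))) (x k))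

/-- The tensor power representation `g ↦ g^{⊗n}`. -/
def tensorRep {d : ℕ} (n : ℕ) (g : Matrix (Fin d) (Fin d) ℂ) : Op (SysPow d n) :=
  tensorOp fun _ => Matrix.toEuclideanCLM (𝕜 := ℂ) g

/-! ### Average error of a variable-length code -/

/-- The average error of a variable-length code on `(ℂ^d)^{⊗n}` with data set `Ω`, encoder
`E ω : S((ℂ^d)^{⊗n}) → S(K ω)` and decoder `D ω : S(K ω) → S((ℂ^d)^{⊗n})`, when the `n` states are
drawn independently from the (discrete) probability `p` on the states of `ℂ^d`:
`∑_ρ p^n(ρ) ∑_ω Tr E_ω(ρ) b²(ρ, D_ω(E_ω(ρ) / Tr E_ω(ρ)))`. -/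
def avgError {d n : ℕ} {Ω : Type} [Fintype Ω] {K : Ω → Type}
    [∀ ω, NormedAddCommGroup (K ω)] [∀ ω, InnerProductSpace ℂ (K ω)]
    (E : ∀ ω, Op (SysPow d n) →ₗ[ℂ] Op (K ω)) (D : ∀ ω, Op (K ω) →ₗ[ℂ] Op (SysPow d n))
    (p : PMF (DensityOp (Sys d))) : ℝ :=
  ∑' ρ : Fin n → DensityOp (Sys d), (∏ k, (p (ρ k)).toReal) *
    ∑ ω, (tr (E ω (tensorOp fun k => (ρ k).1))).re *
      bures (tensorOp fun k => (ρ k).1)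
        (D ω ((tr (E ω (tensorOp fun k => (ρ k).1)))⁻¹ •
          E ω (tensorOp fun k => (ρ k).1))) ^ 2

/-! ### Decomposition of the tensor power under `SU(d)` -/

/-- A subspace of `(ℂ^d)^{⊗n}` that is invariant under all `g^{⊗n}`, `g ∈ SU(d)`. -/
def SUInvariant {d n : ℕ} (V : Submodule ℂ (SysPow d n)) : Prop :=
  ∀ g ∈ Matrix.specialUnitaryGroup (Fin d) ℂ, ∀ v ∈ V, tensorRep n g v ∈ V

/-- An irreducible `SU(d)`-subrepresentation of `(ℂ^d)^{⊗n}`. -/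
def SUIrreducible {d n : ℕ} (V : Submodule ℂ (SysPow d n)) : Prop :=
  SUInvariant V ∧ V ≠ ⊥ ∧ ∀ V' ≤ V, SUInvariant V' → V' = ⊥ ∨ V' = V

/-- `μ` is a weight of `V`: some nonzero `v ∈ V` satisfies `t^{⊗n} v = (∏ i, t_i ^ μ_i) v` for every
element `t` of the diagonal torus of `SU(d)`. Weights of `SU(d)` are defined only up to multiples of
`(1, …, 1)`; in `(ℂ^d)^{⊗n}` they are normalized by `∑ i, μ i = n`. -/
def IsWeight {d n : ℕ} (V : Submodule ℂ (SysPow d n)) (μ : Fin d → ℕ) : Prop :=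
  ∑ i, μ i = n ∧ ∃ v ∈ V, v ≠ 0 ∧
    ∀ t : Fin d → ℂ, Matrix.diagonal t ∈ Matrix.specialUnitaryGroup (Fin d) ℂ →
      tensorRep n (Matrix.diagonal t) v = (∏ i, t i ^ μ i) • v

/-- `l` is the highest weight of `V`: it is a weight, and it dominates every weight of `V`
(dominance order, that is, `l - μ` is a sum of positive roots). -/
def IsHighestWeight {d n : ℕ} (V : Submodule ℂ (SysPow d n)) (l : Fin d → ℕ) : Prop :=
  IsWeight V l ∧ ∀ μ, IsWeight V μ →
    ∀ m : Fin d, ∑ i ∈ Finset.Iic m, μ i ≤ ∑ i ∈ Finset.Iic m, l i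

/-- The set `Y_n` of Young indices `n_1 ≥ ⋯ ≥ n_d`, `∑ i, n_i = n`. -/
def youngIndices (d n : ℕ) : Finset (Fin d → ℕ) := by
  classical
  exact (Finset.piAntidiag Finset.univ n).filter Antitone

/-- The isotypic subspace `W_l = U_l ⊗ V_l`: the sum of all irreducible `SU(d)`-subrepresentations
of `(ℂ^d)^{⊗n}` with highest weight `l`. -/
def isotypic (d n : ℕ) (l : Fin d → ℕ) : Submodule ℂ (SysPow d n) :=
  sSup {V | SUIrreducible V ∧ IsHighestWeight V l}

/-- The orthogonal projection `P_l` onto `W_l`. -/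
def isoProj (d n : ℕ) (l : Fin d → ℕ) : Op (SysPow d n) := (isotypic d n l).starProjection

/-! ### The codes `(E^{δ,n}, D^{δ,n})` -/

/-- `C_{1,d}(x)`: the number of `k ∈ ℤ^d` with Euclidean norm `‖k‖ ≤ x` and `∑ i, k_i = 0`. -/
def latticeCount (d : ℕ) (x : ℝ) : ℕ :=
  Set.ncard {k : Fin d → ℤ | ‖WithLp.toLp 2 (fun i => (k i : ℝ))‖ ≤ x ∧ ∑ i, k i = 0}

/-- `Y_n ∩ U_{k, nδ}`: the Young indices at Euclidean distance at most `nδ` from `k`. -/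
def youngNear (d n : ℕ) (δ : ℝ) (k : Fin d → ℤ) : Finset (Fin d → ℕ) := by
  classical
  exact (youngIndices d n).filter fun l =>
    ‖WithLp.toLp 2 (fun i => (l i : ℝ) - (k i : ℝ))‖ ≤ n * δ

/-- The data set `Y_{δ,n}`. -/
def dataSet (d n : ℕ) (δ : ℝ) : Set (Fin d → ℤ) :=
  {k | ∑ i, k i = (n : ℤ) ∧ (youngNear d n δ k).Nonempty}

theorem dataSet_finite (d n : ℕ) (δ : ℝ) : (dataSet d n δ).Finite := by
  classical
  refine Set.Finite.subset
    (Set.finite_Icc (fun _ : Fin d => -(n + ⌈(n : ℝ) * δ⌉)) (fun _ => n + ⌈(n : ℝ) * δ⌉)) ?_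
  rintro k ⟨-, l, hl⟩
  simp only [youngNear, youngIndices, Finset.mem_filter, Finset.mem_piAntidiag] at hl
  obtain ⟨⟨⟨hs, -⟩, -⟩, hn⟩ := hl
  have key : ∀ i, |(l i : ℝ) - (k i : ℝ)| ≤ n * δ := fun i =>
    (PiLp.norm_apply_le (WithLp.toLp 2 (fun i => (l i : ℝ) - (k i : ℝ))) i).trans hn
  have hle : ∀ i, (l i : ℝ) ≤ n := fun i => by
    have : l i ≤ n := hs ▸ Finset.single_le_sum (fun _ _ => Nat.zero_le _) (Finset.mem_univ i)
    exact_mod_cast this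
  have hc := Int.le_ceil ((n : ℝ) * δ)
  constructor <;> intro i <;> have h1 := abs_le.1 (key i) <;> have h2 := hle i <;>
    have h3 : (0 : ℝ) ≤ l i := Nat.cast_nonneg _
  · have : (-(n + ⌈(n : ℝ) * δ⌉ : ℝ)) ≤ (k i : ℝ) := by linarith
    exact_mod_cast this
  · have : (k i : ℝ) ≤ (n + ⌈(n : ℝ) * δ⌉ : ℝ) := by linarith
    exact_mod_cast this

instance (d n : ℕ) (δ : ℝ) : Fintype (dataSet d n δ) := (dataSet_finite d n δ).fintype

/-- `P_k^{δ,n} = ∑_{l ∈ Y_n ∩ U_{k,nδ}} P_l`. -/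
def codeProj (d n : ℕ) (δ : ℝ) (k : Fin d → ℤ) : Op (SysPow d n) :=
  ∑ l ∈ youngNear d n δ k, isoProj d n l

/-- `M_k^{δ,n} = P_k^{δ,n} / C_{1,d}(nδ)`. -/
def codePOVM (d n : ℕ) (δ : ℝ) (k : Fin d → ℤ) : Op (SysPow d n) :=
  ((latticeCount d (n * δ) : ℂ)⁻¹) • codeProj d n δ k

/-- `H_k^{δ,n}`, the (orthogonal) sum of the `W_l` with `l ∈ Y_n`, `‖l - k‖ ≤ nδ`. -/
def codeSpace (d n : ℕ) (δ : ℝ) (k : Fin d → ℤ) : Submodule ℂ (SysPow d n) :=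
  ⨆ l ∈ youngNear d n δ k, isotypic d n l

/-- The encoder `E_k^{δ,n}(ρ) = √M_k ρ √M_k`, regarded as an operator on `H_k^{δ,n}` (the range of
`M_k` lies in `H_k^{δ,n}`), that is, compressed by the inclusion of `H_k^{δ,n}`. -/
def encoder (d n : ℕ) (δ : ℝ) (k : Fin d → ℤ) :
    Op (SysPow d n) →ₗ[ℂ] Op (codeSpace d n δ k) where
  toFun ρ := (ContinuousLinearMap.adjoint (codeSpace d n δ k).subtypeL) ∘L
    (CFC.sqrt (codePOVM d n δ k) * ρ * CFC.sqrt (codePOVM d n δ k)) ∘L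
    (codeSpace d n δ k).subtypeL
  map_add' ρ σ := by
    simp only [mul_add, add_mul, ContinuousLinearMap.add_comp, ContinuousLinearMap.comp_add]
  map_smul' c ρ := by
    simp only [mul_smul_comm, smul_mul_assoc, ContinuousLinearMap.smul_comp,
      ContinuousLinearMap.comp_smul, RingHom.id_apply]

/-- The decoder `D_k^{δ,n}`: the embedding of the states on `H_k^{δ,n}` into those on
`(ℂ^d)^{⊗n}`. -/
def decoder (d n : ℕ) (δ : ℝ) (k : Fin d → ℤ) :
    Op (codeSpace d n δ k) →ₗ[ℂ] Op (SysPow d n) where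
  toFun σ := (codeSpace d n δ k).subtypeL ∘L σ ∘L
    ContinuousLinearMap.adjoint (codeSpace d n δ k).subtypeL
  map_add' ρ σ := by
    simp only [ContinuousLinearMap.add_comp, ContinuousLinearMap.comp_add]
  map_smul' c ρ := by
    simp only [ContinuousLinearMap.smul_comp, ContinuousLinearMap.comp_smul, RingHom.id_apply]

/-- The average error `ε_{n,p}(E^{δ,n}, D^{δ,n})`. -/
def codeError (d n : ℕ) (δ : ℝ) (p : PMF (DensityOp (Sys d))) : ℝ :=
  avgError (Ω := dataSet d n δ) (K := fun k => codeSpace d n δ k.1)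
    (fun k => encoder d n δ k.1) (fun k => decoder d n δ k.1) p

end QCode

end

noncomputable section

namespace QCode

open scoped InnerProductSpace

/-! ### The tensor power representation -/

section TensorPower

variable {d n : ℕ}

/-! The error is bounded above and, for large n, below by powers of n, so its logarithm is O(log n).
The upper bound is crude: each datum contributes at most 1 and there are at most 3n + 1 data.

For the lower bound, the code projections commute with g^{⊗n}, so the source may be taken to emit
computational basis strings `s`. The error on `s` is then the sum over k of q²(1 - q)/C with q =
‖P_k s‖ (`error_term_ketbra`, `tensorRep_single_error`). It suffices to find, for the strings with j
+ 1 ones, 2(j + 1) ≤ n, one datum for which 1 - q and the average of q² are at least inverse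
polynomial. Take the window whose extreme Young index is (n - j - 1, j + 1) (`exists_data`). The
code space then contains all highest weight vectors with j + 1 ones. Their dimension is at least
C(n, j+1) - C(n, j) ≥ C(n, j+1)/(n + 1), which bounds the average of q² (`choose_le_sum_norm_sq`).
The code space has no component with j ones, so the raising operator kills the part of its vectors
with j + 1 ones. It does not kill `s`, so `s` sticks out: 1 - q² ≥ 1/n²
(`norm_sq_starProjection_single_le`). Weighting by the binomial distribution, with the likelier
state labelled 0, the indices 1 ≤ j ≤ n/2 carry at least 1/2 - aⁿ of the mass.

The representation theory is handled by one operator commuting with the group, the sum of all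
coordinate swaps: its eigenvalue determines the highest weight, which yields orthogonality of the
isotypic spaces and places the highest weight vectors in them. -/

theorem tensorRep_apply (g : Matrix (Fin d) (Fin d) ℂ) (v : SysPow d n) (x : Fin n → Fin d) :
    tensorRep n g v x = ∑ y : Fin n → Fin d, (∏ k, g (x k) (y k)) * v y := by
  simp only [tensorRep, tensorOp, Matrix.ofLp_toEuclideanCLM, Matrix.mulVec, dotProduct,
    Matrix.of_apply]
  refine Finset.sum_congr rfl fun y _ => ?_
  congr 1
  refine Finset.prod_congr rfl fun k _ => ?_
  simp

theorem tensorRep_eq (g : Matrix (Fin d) (Fin d) ℂ) :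
    tensorRep n g = Matrix.toEuclideanCLM (𝕜 := ℂ)
      (Matrix.of fun x y : Fin n → Fin d => ∏ k, g (x k) (y k)) := by
  ext v x
  rw [tensorRep_apply]
  simp [Matrix.mulVec, dotProduct]

theorem tensorRep_mul (g h : Matrix (Fin d) (Fin d) ℂ) :
    tensorRep n (g * h) = tensorRep n g * tensorRep n h := by
  simp only [tensorRep_eq, ← map_mul]
  congr 1
  ext x y
  simp only [Matrix.mul_apply, Matrix.of_apply, ← Finset.prod_mul_distrib]
  rw [Finset.prod_univ_sum]
  simp

theorem tensorRep_one : tensorRep n (1 : Matrix (Fin d) (Fin d) ℂ) = 1 := by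
  rw [tensorRep_eq, ← map_one (Matrix.toEuclideanCLM (𝕜 := ℂ) (n := Fin n → Fin d))]
  congr 1
  ext x y
  simp only [Matrix.of_apply, Matrix.one_apply, Finset.prod_ite_zero, Finset.prod_const_one]
  simp [funext_iff]

theorem tensorRep_star (g : Matrix (Fin d) (Fin d) ℂ) :
    tensorRep n (star g) = ContinuousLinearMap.adjoint (tensorRep n g) := by
  rw [← ContinuousLinearMap.star_eq_adjoint]
  simp only [tensorRep_eq, ← map_star]
  congr 1
  ext x y
  simp

theorem tensorRep_star_mul_self {g : Matrix (Fin d) (Fin d) ℂ}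
    (hg : g ∈ Matrix.specialUnitaryGroup (Fin d) ℂ) (v : SysPow d n) :
    tensorRep n (star g) (tensorRep n g v) = v := by
  have h : star g * g = 1 := (Matrix.mem_unitaryGroup_iff').1 hg.1
  have := congrArg (fun A : Op (SysPow d n) => A v) (tensorRep_mul (n := n) (star g) g)
  simpa [h, tensorRep_one] using this.symm

theorem norm_tensorRep {g : Matrix (Fin d) (Fin d) ℂ}
    (hg : g ∈ Matrix.specialUnitaryGroup (Fin d) ℂ) (v : SysPow d n) :
    ‖tensorRep n g v‖ = ‖v‖ := by
  have h : ⟪tensorRep n g v, tensorRep n g v⟫_ℂ = ⟪v, v⟫_ℂ := by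
    rw [← ContinuousLinearMap.adjoint_inner_right, ← tensorRep_star, tensorRep_star_mul_self hg]
  rw [@norm_eq_sqrt_re_inner ℂ, @norm_eq_sqrt_re_inner ℂ, h]

theorem tensorRep_single (g : Matrix (Fin d) (Fin d) ℂ) (s x : Fin n → Fin d) :
    tensorRep n g (EuclideanSpace.single s 1) x = ∏ k, g (x k) (s k) := by
  simp [tensorRep_apply]

theorem tensorRep_diagonal_apply (t : Fin d → ℂ) (v : SysPow d n) (x : Fin n → Fin d) :
    tensorRep n (Matrix.diagonal t) v x = (∏ k, t (x k)) * v x := by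
  rw [tensorRep_apply, Finset.sum_eq_single x]
  · simp
  · intro y _ hy
    obtain ⟨k, hk⟩ := Function.ne_iff.1 hy
    rw [Finset.prod_eq_zero (Finset.mem_univ k), zero_mul]
    exact Matrix.diagonal_apply_ne _ (Ne.symm hk)
  · simp

/-! ### Invariant subspaces and complete reducibility -/

theorem star_mem_specialUnitaryGroup {g : Matrix (Fin d) (Fin d) ℂ}
    (hg : g ∈ Matrix.specialUnitaryGroup (Fin d) ℂ) :
    star g ∈ Matrix.specialUnitaryGroup (Fin d) ℂ := by
  rw [Matrix.mem_specialUnitaryGroup_iff] at hg ⊢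
  refine ⟨Unitary.star_mem hg.1, ?_⟩
  rw [Matrix.star_eq_conjTranspose, Matrix.det_conjTranspose, hg.2, star_one]

theorem SUInvariant.orthogonal {V : Submodule ℂ (SysPow d n)} (hV : SUInvariant V) :
    SUInvariant Vᗮ := by
  intro g hg v hv
  rw [Submodule.mem_orthogonal] at hv ⊢
  intro u hu
  rw [← ContinuousLinearMap.adjoint_inner_left, ← tensorRep_star]
  exact hv _ (hV _ (star_mem_specialUnitaryGroup hg) _ hu)

theorem SUInvariant.inf {V W : Submodule ℂ (SysPow d n)} (hV : SUInvariant V)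
    (hW : SUInvariant W) : SUInvariant (V ⊓ W) :=
  fun g hg v hv => ⟨hV g hg v hv.1, hW g hg v hv.2⟩

theorem SUInvariant.of_sSup {T : Set (Submodule ℂ (SysPow d n))} (hT : ∀ V ∈ T, SUInvariant V) :
    SUInvariant (sSup T) := by
  intro g hg v hv
  have : sSup T ≤ (sSup T).comap (tensorRep n g : SysPow d n →ₗ[ℂ] SysPow d n) :=
    sSup_le fun V hV w hw => (le_sSup hV : V ≤ _) (hT V hV g hg w hw)
  exact this hv

theorem SUInvariant.of_iSup {ι : Sort*} {V : ι → Submodule ℂ (SysPow d n)}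
    (hV : ∀ i, SUInvariant (V i)) : SUInvariant (⨆ i, V i) :=
  SUInvariant.of_sSup (by rintro _ ⟨i, rfl⟩; exact hV i)

/-- The complement is invariant as well, so g carries the orthogonal decomposition of v to that of g
v. -/
theorem SUInvariant.starProjection_comm {V : Submodule ℂ (SysPow d n)} (hV : SUInvariant V)
    {g : Matrix (Fin d) (Fin d) ℂ} (hg : g ∈ Matrix.specialUnitaryGroup (Fin d) ℂ)
    (v : SysPow d n) :
    V.starProjection (tensorRep n g v) = tensorRep n g (V.starProjection v) := by
  refine Submodule.eq_starProjection_of_mem_orthogonal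
    (hV g hg _ (V.starProjection_apply_mem v)) ?_
  rw [← map_sub]
  exact hV.orthogonal g hg _ (Submodule.sub_starProjection_mem_orthogonal v)

theorem SUInvariant.exists_irreducible_le (m : ℕ) {U : Submodule ℂ (SysPow d n)}
    (hm : Module.finrank ℂ U ≤ m) (hU : SUInvariant U) (h0 : U ≠ ⊥) :
    ∃ V ≤ U, SUIrreducible V := by
  induction m generalizing U with
  | zero => exact absurd (Submodule.finrank_eq_zero.1 (Nat.le_zero.1 hm)) h0
  | succ m ih =>
    by_cases h : ∀ V' ≤ U, SUInvariant V' → V' = ⊥ ∨ V' = U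
    · exact ⟨U, le_rfl, hU, h0, h⟩
    · push Not at h
      obtain ⟨W, hWU, hW, hW0, hne⟩ := h
      have hlt := Submodule.finrank_lt_finrank_of_lt (lt_of_le_of_ne hWU hne)
      obtain ⟨V, hVW, hV⟩ := ih (by omega) hW hW0
      exact ⟨V, hVW.trans hWU, hV⟩

/-- Otherwise the complement of the span inside U would contain one more irreducible, which would
lie in the span and be orthogonal to it. -/
theorem SUInvariant.le_sSup_irreducible {U : Submodule ℂ (SysPow d n)} (hU : SUInvariant U) :
    U ≤ sSup {V | SUIrreducible V ∧ V ≤ U} := by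
  set W := sSup {V | SUIrreducible V ∧ V ≤ U} with hWdef
  have hW : SUInvariant W := SUInvariant.of_sSup fun V hV => hV.1.1
  have hWU : W ≤ U := sSup_le fun V hV => hV.2
  by_cases h0 : U ⊓ Wᗮ = ⊥
  · have := Submodule.sup_orthogonal_inf_of_hasOrthogonalProjection hWU
    rw [inf_comm, h0, sup_bot_eq] at this
    exact this.ge
  · obtain ⟨V, hVU, hV⟩ := SUInvariant.exists_irreducible_le _ le_rfl (hU.inf hW.orthogonal) h0
    have h1 : V ≤ W := le_sSup ⟨hV, hVU.trans inf_le_left⟩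
    have h2 : V ≤ W ⊓ Wᗮ := le_inf h1 (hVU.trans inf_le_right)
    rw [Submodule.inf_orthogonal_eq_bot] at h2
    exact absurd (le_bot_iff.1 h2) hV.2.1

theorem isotypic_invariant (l : Fin d → ℕ) : SUInvariant (isotypic d n l) :=
  SUInvariant.of_sSup fun _ hV => hV.1.1

end TensorPower

/-! ### Weights of qubit strings -/

section Qubit

variable {n : ℕ}

/-- The number of ones of a binary string. -/
def wt (x : Fin n → Fin 2) : ℕ := (Finset.univ.filter fun k => x k = 1).card

theorem wt_le (x : Fin n → Fin 2) : wt x ≤ n :=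
  (Finset.card_le_univ _).trans_eq (Fintype.card_fin n)

theorem card_filter_eq_zero (x : Fin n → Fin 2) :
    (Finset.univ.filter fun k => x k = 0).card = n - wt x := by
  have h := Finset.card_filter_add_card_filter_not (s := (Finset.univ : Finset (Fin n)))
    (fun k => x k = 1)
  have h2 : (Finset.univ.filter fun k => ¬ x k = 1) = Finset.univ.filter fun k => x k = 0 :=
    Finset.filter_congr fun k _ => by omega
  rw [h2, Finset.card_univ, Fintype.card_fin] at h
  unfold wt
  omega

theorem prod_comp_eq_pow_wt {M : Type*} [CommMonoid M] (t : Fin 2 → M) (x : Fin n → Fin 2) :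
    ∏ k, t (x k) = t 0 ^ (n - wt x) * t 1 ^ wt x := by
  have h : ∀ k, t (x k) = (if x k = 1 then t 1 else 1) * (if x k = 0 then t 0 else 1) := by
    intro k
    rcases (by omega : x k = 0 ∨ x k = 1) with h | h <;> simp [h]
  simp only [h, Finset.prod_mul_distrib]
  rw [← Finset.prod_filter, ← Finset.prod_filter, Finset.prod_const, Finset.prod_const,
    card_filter_eq_zero, mul_comm]
  rfl

theorem wt_update_one {x : Fin n → Fin 2} {k : Fin n} (h : x k = 0) :
    wt (Function.update x k 1) = wt x + 1 := by
  have : (Finset.univ.filter fun i => Function.update x k 1 i = 1) =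
      insert k (Finset.univ.filter fun i => x i = 1) := by
    ext i
    by_cases hi : i = k
    · subst hi; simp
    · simp [hi]
  rw [wt, this, Finset.card_insert_of_notMem (by simp [h]), wt]

theorem wt_update_zero {x : Fin n → Fin 2} {k : Fin n} (h : x k = 1) :
    wt (Function.update x k 0) + 1 = wt x := by
  rw [← wt_update_one (k := k) (by simp), Function.update_idem, ← h, Function.update_eq_self]

theorem wt_comp_perm (x : Fin n → Fin 2) (σ : Equiv.Perm (Fin n)) : wt (x ∘ σ) = wt x := by
  unfold wt
  refine Finset.card_equiv σ fun i => ?_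
  simp

theorem wt_one_sub (x : Fin n → Fin 2) : wt (fun k => 1 - x k) = n - wt x := by
  rw [← card_filter_eq_zero, wt]
  congr 1
  refine Finset.filter_congr fun k _ => ?_
  omega

/-! ### Weight components -/

/-- The vectors of `(ℂ²)^{⊗n}` supported on the strings with `j` ones. -/
def weightSpace (n j : ℕ) : Submodule ℂ (SysPow 2 n) where
  carrier := {v | ∀ x, wt x ≠ j → v x = 0}
  add_mem' := fun {a b} ha hb x hx => by simp [ha x hx, hb x hx]
  zero_mem' := fun x _ => rfl
  smul_mem' := fun c v hv x hx => by simp [hv x hx]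

/-- The component of a vector supported on the strings with `j` ones. -/
def weightPart (j : ℕ) (v : SysPow 2 n) : SysPow 2 n :=
  WithLp.toLp 2 fun x => if wt x = j then v x else 0

theorem weightPart_apply (j : ℕ) (v : SysPow 2 n) (x : Fin n → Fin 2) :
    weightPart j v x = if wt x = j then v x else 0 := rfl

theorem weightPart_mem_weightSpace (j : ℕ) (v : SysPow 2 n) :
    weightPart j v ∈ weightSpace n j := fun x hx => by simp [weightPart_apply, hx]

/-- Stability under a diagonal operator passes to polynomials in it; a Lagrange polynomial will then
cut out a single weight. -/
theorem mem_of_forall_eval_mul {V : Submodule ℂ (SysPow 2 n)} {c : (Fin n → Fin 2) → ℂ}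
    (hc : ∀ v ∈ V, WithLp.toLp 2 (fun x => c x * v x) ∈ V) (p : Polynomial ℂ)
    {v : SysPow 2 n} (hv : v ∈ V) :
    WithLp.toLp 2 (fun x => p.eval (c x) * v x) ∈ V := by
  induction p using Polynomial.induction_on' with
  | add p q hp hq =>
    convert V.add_mem hp hq using 1
    ext x
    simp [add_mul]
  | monomial k a =>
    have h : ∀ k : ℕ, WithLp.toLp 2 (fun x => c x ^ k * v x) ∈ V := by
      intro k
      induction k with
      | zero => simpa using hv
      | succ k ih =>
        convert hc _ ih using 1
        ext x
        simp [pow_succ]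
        ring
    convert V.smul_mem a (h k) using 1
    ext x
    simp [mul_assoc]

theorem diagonal_mem_specialUnitaryGroup {z : ℂ} (hz : ‖z‖ = 1) :
    Matrix.diagonal ![z, z⁻¹] ∈ Matrix.specialUnitaryGroup (Fin 2) ℂ := by
  have h0 : z ≠ 0 := by rintro rfl; simp at hz
  have h1 : (starRingEnd ℂ) z = z⁻¹ := (Complex.inv_eq_conj hz).symm
  rw [Matrix.mem_specialUnitaryGroup_iff, Matrix.mem_unitaryGroup_iff]
  constructor
  · ext i j
    fin_cases i <;> fin_cases j <;>
      simp [Matrix.mul_apply, Fin.sum_univ_two, Matrix.star_apply, h1, h0]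
  · simp [Fin.prod_univ_two, h0]

/-- A number of modulus one whose powers with exponents `n - 2 w`, `0 ≤ w ≤ n`, are distinct. -/
theorem exists_torus_element (n : ℕ) : ∃ z : ℂ, ‖z‖ = 1 ∧ ∀ w ≤ n, ∀ w' ≤ n,
    z ^ (n - w) * z⁻¹ ^ w = z ^ (n - w') * z⁻¹ ^ w' → w = w' := by
  -- Two exponents n - 2w differ by at most 2n in absolute value, so order 2n + 1 keeps the powers
  -- apart.
  have hp := Complex.isPrimitiveRoot_exp (2 * n + 1) (by omega)
  set z := Complex.exp (2 * Real.pi * Complex.I / ((2 * n + 1 : ℕ) : ℂ)) with hz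
  have h0 : z ≠ 0 := Complex.exp_ne_zero _
  refine ⟨z, hp.norm'_eq_one (by omega), fun w hw w' hw' h => ?_⟩
  have key : ∀ w ≤ n, z ^ (n - w) * z⁻¹ ^ w = z ^ ((n : ℤ) - 2 * w) := by
    intro w hw
    rw [inv_pow, ← zpow_natCast, ← zpow_natCast, ← zpow_neg, ← zpow_add₀ h0]
    congr 1
    push_cast [hw]
    ring
  rw [key w hw, key w' hw'] at h
  have h1 : z ^ ((2 * w' - 2 * w : ℤ)) = 1 := by
    have : (2 * w' - 2 * w : ℤ) = ((n : ℤ) - 2 * w) - ((n : ℤ) - 2 * w') := by ring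
    rw [this, zpow_sub₀ h0, h, div_self (zpow_ne_zero _ h0)]
  rw [hp.zpow_eq_one_iff_dvd] at h1
  have h2 := Int.eq_zero_of_abs_lt_dvd h1 (by rw [abs_lt]; constructor <;> push_cast <;> omega)
  omega

theorem SUInvariant.weightPart_mem {V : Submodule ℂ (SysPow 2 n)} (hV : SUInvariant V) (j : ℕ)
    {v : SysPow 2 n} (hv : v ∈ V) : weightPart j v ∈ V := by
  obtain ⟨z, hz, hinj⟩ := exists_torus_element n
  set c : (Fin n → Fin 2) → ℂ := fun x => z ^ (n - wt x) * z⁻¹ ^ wt x with hc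
  have hcV : ∀ v ∈ V, WithLp.toLp 2 (fun x => c x * v x) ∈ V := by
    intro v hv
    convert hV _ (diagonal_mem_specialUnitaryGroup hz) v hv using 1
    ext x
    rw [tensorRep_diagonal_apply, prod_comp_eq_pow_wt]
    rfl
  set f : ℕ → ℂ := fun w => z ^ (n - w) * z⁻¹ ^ w with hf
  have hinj' : Set.InjOn f (Finset.range (n + 1) : Set ℕ) := fun a ha b hb h =>
    hinj a (by simpa [Nat.lt_succ_iff] using ha) b (by simpa [Nat.lt_succ_iff] using hb) h
  convert mem_of_forall_eval_mul hcV
    (Lagrange.interpolate (Finset.range (n + 1)) f fun w => if w = j then 1 else 0) hv using 1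
  ext x
  have := Lagrange.eval_interpolate_at_node (fun w => if w = j then (1 : ℂ) else 0) hinj'
    (i := wt x) (by simpa [Nat.lt_succ_iff] using wt_le x)
  rw [weightPart_apply]
  change _ = Polynomial.eval (f (wt x)) _ * v x
  rw [this]
  split_ifs <;> simp

/-- On a string the torus acts by a scalar depending only on its number of ones, and one torus
element with distinct eigenvalues already forces the support. -/
theorem isWeight_iff {V : Submodule ℂ (SysPow 2 n)} {μ : Fin 2 → ℕ} :
    IsWeight V μ ↔ μ 0 + μ 1 = n ∧ ∃ v ∈ V, v ≠ 0 ∧ v ∈ weightSpace n (μ 1) := by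
  unfold IsWeight
  rw [Fin.sum_univ_two]
  refine and_congr_right fun hμ => exists_congr fun v => and_congr_right fun _ =>
    and_congr_right fun _ => ⟨fun h x hx => ?_, fun h t _ => ?_⟩
  · obtain ⟨z, hz, hinj⟩ := exists_torus_element n
    have h1 := congrArg (fun u : SysPow 2 n => u x)
      (h _ (diagonal_mem_specialUnitaryGroup hz))
    simp only [tensorRep_diagonal_apply, prod_comp_eq_pow_wt, Fin.prod_univ_two] at h1
    by_contra h0
    rw [PiLp.smul_apply, smul_eq_mul] at h1
    have h2 := mul_right_cancel₀ h0 h1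
    refine hx (hinj _ (wt_le x) _ (by omega) ?_)
    rw [← show μ 0 = n - μ 1 by omega]
    simpa using h2
  · ext x
    rw [tensorRep_diagonal_apply, prod_comp_eq_pow_wt, Fin.prod_univ_two]
    by_cases hx : wt x = μ 1
    · rw [hx, show n - μ 1 = μ 0 by omega]
      simp
    · simp [h x hx]

/-- Both weights sum to n, so dominance is a comparison of second entries: the highest weight is the
one with fewest ones. -/
theorem isHighestWeight_iff {V : Submodule ℂ (SysPow 2 n)} {l : Fin 2 → ℕ} :
    IsHighestWeight V l ↔ IsWeight V l ∧ ∀ μ, IsWeight V μ → l 1 ≤ μ 1 := by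
  unfold IsHighestWeight
  refine and_congr_right fun hl => forall_congr' fun μ => forall_congr' fun hμ => ?_
  have h1 := hl.1
  have h2 := hμ.1
  rw [Fin.sum_univ_two] at h1 h2
  have e0 : (Finset.Iic (0 : Fin 2)) = {0} := by decide
  have e1 : (Finset.Iic (1 : Fin 2)) = {0, 1} := by decide
  simp only [Fin.forall_fin_two, e0, e1, Finset.sum_singleton]
  rw [Finset.sum_pair (by decide), Finset.sum_pair (by decide)]
  omega

theorem SUInvariant.apply_eq_zero_of_not_isWeight {V : Submodule ℂ (SysPow 2 n)}
    (hV : SUInvariant V) {i : ℕ} (hi : ¬ IsWeight V ![n - i, i]) {v : SysPow 2 n} (hv : v ∈ V)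
    {x : Fin n → Fin 2} (hx : wt x = i) : v x = 0 := by
  by_contra h0
  refine hi (isWeight_iff.2 ⟨?_, weightPart i v, hV.weightPart_mem i hv, fun h => h0 ?_,
    weightPart_mem_weightSpace i v⟩)
  · have := wt_le x
    simp
    omega
  · have := congrArg (fun u : SysPow 2 n => u x) h
    simpa [weightPart_apply, hx] using this

theorem IsHighestWeight.apply_eq_zero {V : Submodule ℂ (SysPow 2 n)} {l : Fin 2 → ℕ}
    (hV : SUInvariant V) (hl : IsHighestWeight V l) {v : SysPow 2 n} (hv : v ∈ V)
    {x : Fin n → Fin 2} (hx : wt x < l 1) : v x = 0 :=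
  hV.apply_eq_zero_of_not_isWeight
    (fun h => by have := (isHighestWeight_iff.1 hl).2 _ h; simp at this; omega) hv rfl

/-! ### The raising operator -/

/-- The raising operator: `(raise v) y = ∑ v(x)` over the `x` obtained from `y` by changing one
`0` into `1`. -/
def raise (n : ℕ) : SysPow 2 n →ₗ[ℂ] ((Fin n → Fin 2) → ℂ) where
  toFun v y := ∑ k, if y k = 0 then v (Function.update y k 1) else 0
  map_add' u v := by
    ext y
    simp only [Pi.add_apply, ← Finset.sum_add_distrib]
    refine Finset.sum_congr rfl fun k _ => ?_
    split_ifs <;> simp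
  map_smul' c v := by
    ext y
    simp only [Pi.smul_apply, RingHom.id_apply, Finset.smul_sum]
    refine Finset.sum_congr rfl fun k _ => ?_
    split_ifs <;> simp

theorem raise_apply (v : SysPow 2 n) (y : Fin n → Fin 2) :
    raise n v y = ∑ k, if y k = 0 then v (Function.update y k 1) else 0 := rfl

/-- The plane rotations. -/
def rotation (θ : ℝ) : Matrix (Fin 2) (Fin 2) ℂ :=
  !![(Real.cos θ : ℂ), (Real.sin θ : ℂ); -(Real.sin θ : ℂ), (Real.cos θ : ℂ)]

theorem rotation_mem (θ : ℝ) : rotation θ ∈ Matrix.specialUnitaryGroup (Fin 2) ℂ := by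
  have h : (Real.cos θ : ℂ) ^ 2 + (Real.sin θ : ℂ) ^ 2 = 1 := by
    exact_mod_cast congrArg (fun r : ℝ => (r : ℂ)) (Real.cos_sq_add_sin_sq θ)
  rw [Matrix.mem_specialUnitaryGroup_iff, Matrix.mem_unitaryGroup_iff]
  constructor
  · ext i j
    fin_cases i <;> fin_cases j <;>
      simp [rotation, Matrix.mul_apply, Fin.sum_univ_two, Matrix.star_apply, Complex.conj_ofReal,
        -Complex.ofReal_cos, -Complex.ofReal_sin] <;> first | ring1 | linear_combination h
  · rw [rotation, Matrix.det_fin_two_of]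
    linear_combination h

theorem hasDerivAt_rotation (a b : Fin 2) :
    HasDerivAt (fun θ : ℝ => rotation θ a b) (!![(0 : ℂ), 1; -1, 0] a b) 0 := by
  have hs := (Real.hasDerivAt_sin 0).ofReal_comp
  have hc := (Real.hasDerivAt_cos 0).ofReal_comp
  simp only [Real.cos_zero, Real.sin_zero, neg_zero] at hs hc
  fin_cases a <;> fin_cases b
  · simpa [rotation] using hc
  · simpa [rotation] using hs
  · simpa [rotation] using hs.fun_neg
  · simpa [rotation] using hc

theorem rotation_zero : rotation 0 = 1 := by
  ext i j
  fin_cases i <;> fin_cases j <;> simp [rotation]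

/-- The derivative is the raising operator minus the lowering operator: this is how group invariance
becomes a statement about the raising operator. -/
theorem hasDerivAt_tensorRep_rotation (v : SysPow 2 n) (x : Fin n → Fin 2) :
    HasDerivAt (fun θ : ℝ => tensorRep n (rotation θ) v x)
      (∑ k, ∑ b, (!![(0 : ℂ), 1; -1, 0] (x k) b) * v (Function.update x k b)) 0 := by
  have h : HasDerivAt (fun θ : ℝ => ∑ y : Fin n → Fin 2, (∏ k, rotation θ (x k) (y k)) * v y)
      (∑ y : Fin n → Fin 2, (∑ k, (∏ i ∈ Finset.univ.erase k, rotation 0 (x i) (y i)) •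
        (!![(0 : ℂ), 1; -1, 0] (x k) (y k))) * v y) 0 := by
    refine HasDerivAt.fun_sum fun y _ => HasDerivAt.mul_const ?_ _
    exact HasDerivAt.fun_finsetProd fun k _ => hasDerivAt_rotation _ _
  simp only [tensorRep_apply]
  convert h using 1
  simp only [Finset.sum_mul]
  conv_rhs => rw [Finset.sum_comm]
  refine Finset.sum_congr rfl fun k _ => ?_
  -- At θ = 0 the remaining factors are entries of the identity, so only strings agreeing with x off
  -- k survive.
  refine Finset.sum_of_injOn (fun b => Function.update x k b)
    (fun a _ b _ hab => by simpa using congrFun hab k) (by simp [Set.MapsTo]) ?_ ?_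
  · intro y _ hy
    have : ∃ i, i ≠ k ∧ x i ≠ y i := by
      by_contra hcon
      push Not at hcon
      refine hy ⟨y k, by simp, funext fun i => ?_⟩
      by_cases hi : i = k
      · subst hi; simp
      · simpa [hi] using hcon i hi
    obtain ⟨i, hik, hi⟩ := this
    rw [Finset.prod_eq_zero (Finset.mem_erase.2 ⟨hik, Finset.mem_univ i⟩)]
    · simp
    · rw [rotation_zero, Matrix.one_apply_ne hi]
  · intro b _
    rw [Finset.prod_eq_one]
    · simp
    · intro i hi
      simp [rotation_zero, Finset.ne_of_mem_erase hi]

/-- If all vectors of an invariant subspace have zero component of weight `i`, then so do their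
images under the raising operator. -/
theorem SUInvariant.raise_eq_zero {V : Submodule ℂ (SysPow 2 n)} (hV : SUInvariant V) {i : ℕ}
    (hi : ∀ v ∈ V, ∀ x, wt x = i → v x = 0) {v : SysPow 2 n} (hv : v ∈ V) {x : Fin n → Fin 2}
    (hx : wt x = i) : raise n v x = 0 := by
  -- Keeping only the component with i + 1 ones removes the lowering terms, which would read strings
  -- with i - 1 ones.
  have hd := hasDerivAt_tensorRep_rotation (weightPart (i + 1) v) x
  have h0 : (fun θ : ℝ => tensorRep n (rotation θ) (weightPart (i + 1) v) x) = fun _ => 0 :=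
    funext fun θ => hi _ (hV _ (rotation_mem θ) _ (hV.weightPart_mem _ hv)) x hx
  rw [h0] at hd
  rw [raise_apply]
  refine Eq.trans ?_ (hd.unique (hasDerivAt_const (0 : ℝ) (0 : ℂ)))
  refine Finset.sum_congr rfl fun k _ => ?_
  rw [Fin.sum_univ_two]
  rcases (by omega : x k = 0 ∨ x k = 1) with h | h
  · simp [h, weightPart_apply, wt_update_one h, hx]
  · have := wt_update_zero h
    have h1 : wt (Function.update x k 0) ≠ i + 1 := by omega
    simp [h, weightPart_apply, h1]

/-! ### The Casimir operator -/

/-- The sum of all coordinate swaps; up to an affine change this is the Casimir operator. -/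
def swapSum (n : ℕ) : SysPow 2 n →ₗ[ℂ] SysPow 2 n where
  toFun v := WithLp.toLp 2 fun x => ∑ a, ∑ b, v (x ∘ Equiv.swap a b)
  map_add' u v := by
    ext x
    simp [Finset.sum_add_distrib]
  map_smul' c v := by
    ext x
    simp [Finset.mul_sum]

theorem swapSum_apply (v : SysPow 2 n) (x : Fin n → Fin 2) :
    swapSum n v x = ∑ a, ∑ b, v (x ∘ Equiv.swap a b) := rfl

theorem swapSum_isSymmetric (n : ℕ) : (swapSum n).IsSymmetric := by
  intro u v
  simp only [PiLp.inner_apply, swapSum_apply, sum_inner, inner_sum]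
  rw [Finset.sum_comm]
  conv_rhs => rw [Finset.sum_comm]
  refine Finset.sum_congr rfl fun a _ => ?_
  rw [Finset.sum_comm]
  conv_rhs => rw [Finset.sum_comm]
  refine Finset.sum_congr rfl fun b _ => ?_
  refine Fintype.sum_equiv ((Equiv.swap a b).arrowCongr (Equiv.refl _)) _ _ fun x => ?_
  simp [Equiv.arrowCongr, Function.comp_def]

theorem tensorRep_comp_perm (g : Matrix (Fin 2) (Fin 2) ℂ) (v : SysPow 2 n)
    (σ : Equiv.Perm (Fin n)) (x : Fin n → Fin 2) :
    tensorRep n g v (x ∘ σ) = tensorRep n g (WithLp.toLp 2 fun y => v (y ∘ σ)) x := by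
  simp only [tensorRep_apply]
  refine Fintype.sum_equiv (σ.arrowCongr (Equiv.refl _)) _ _ fun y => ?_
  have h := Equiv.prod_comp σ fun k => g (x k) (y (σ.symm k))
  simp only [Equiv.symm_apply_apply] at h
  simp [Equiv.arrowCongr, Function.comp_def, h]

theorem swapSum_tensorRep (g : Matrix (Fin 2) (Fin 2) ℂ) (v : SysPow 2 n) :
    swapSum n (tensorRep n g v) = tensorRep n g (swapSum n v) := by
  have h : swapSum n v = ∑ a, ∑ b, WithLp.toLp 2 fun x => v (x ∘ Equiv.swap a b) := by
    ext x
    simp [swapSum_apply]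
  ext x
  rw [h, swapSum_apply]
  simp [map_sum, tensorRep_comp_perm]

/-- The value of `swapSum` on the irreducible representations of highest weight `(n - m, m)`. -/
def swapValue (n m : ℕ) : ℂ := (n : ℂ) ^ 2 - 2 * m * (n + 1 - m)

/-- The value is quadratic in m and symmetric under m ↦ n + 1 - m, hence injective on the half 2m ≤
n. -/
theorem swapValue_injOn {m m' : ℕ} (hm : 2 * m ≤ n) (hm' : 2 * m' ≤ n)
    (h : swapValue n m = swapValue n m') : m = m' := by
  have h1 : ((m : ℂ) - m') * (n + 1 - m - m') = 0 := by
    unfold swapValue at h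
    linear_combination (-1 / 2 : ℂ) * h
  rcases mul_eq_zero.1 h1 with h2 | h2
  · exact_mod_cast sub_eq_zero.1 h2
  · have h3 : ((n + 1 : ℕ) : ℂ) = ((m + m' : ℕ) : ℂ) := by
      push_cast
      linear_combination h2
    have := Nat.cast_injective h3
    omega

/-- Swapping the one at a with a zero at b moves that one to b. These are the terms of `raise` at x
with position a cleared, except for b = a, which returns v x. -/
theorem sum_swap_eq_neg {v : SysPow 2 n} {x : Fin n → Fin 2} {a : Fin n} (ha : x a = 1)
    (h : raise n v (Function.update x a 0) = 0) :
    ∑ b, (if x b = 0 then v (x ∘ Equiv.swap a b) else 0) = - v x := by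
  rw [raise_apply] at h
  have key : ∀ b, (if Function.update x a 0 b = 0 then
      v (Function.update (Function.update x a 0) b 1) else 0) =
      (if b = a then v x else 0) + if x b = 0 then v (x ∘ Equiv.swap a b) else 0 := by
    intro b
    by_cases hb : b = a
    · subst hb
      have : Function.update x b 1 = x := by rw [← ha, Function.update_eq_self]
      simp [ha, this]
    · rcases (by omega : x b = 0 ∨ x b = 1) with hxb | hxb
      · have : Function.update (Function.update x a 0) b 1 = x ∘ Equiv.swap a b := by
          ext i
          by_cases hi : i = b
          · subst hi; simp [ha]
          · by_cases hia : i = a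
            · subst hia; simp [hxb, hi]
            · simp [hi, hia, Equiv.swap_apply_of_ne_of_ne]
        simp [hb, hxb, this]
      · simp [hb, hxb]
  simp only [key, Finset.sum_add_distrib, Finset.sum_ite_eq', Finset.mem_univ, if_true] at h
  linear_combination h

/-- Pairs of equal letters fix x and contribute j² + (n - j)². Unequal pairs, in either order,
contribute -j by `sum_swap_eq_neg`. The total is n² - 2j(n + 1 - j). -/
theorem swapSum_eq_smul {j : ℕ} {v : SysPow 2 n} (hv : v ∈ weightSpace n j)
    (h : ∀ y, wt y + 1 = j → raise n v y = 0) : swapSum n v = swapValue n j • v := by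
  ext x
  rw [swapSum_apply, PiLp.smul_apply]
  by_cases hx : wt x = j
  swap
  · rw [hv x hx, smul_zero]
    exact Finset.sum_eq_zero fun a _ => Finset.sum_eq_zero fun b _ =>
      hv _ (by rwa [wt_comp_perm])
  have key : ∀ a b, v (x ∘ Equiv.swap a b) =
      ((if x a = 1 then (if x b = 1 then v x else 0) else 0) +
      (if x a = 0 then (if x b = 0 then v x else 0) else 0)) +
      ((if x a = 1 then (if x b = 0 then v (x ∘ Equiv.swap a b) else 0) else 0) +
      (if x b = 1 then (if x a = 0 then v (x ∘ Equiv.swap b a) else 0) else 0)) := by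
    intro a b
    have same : x a = x b → x ∘ Equiv.swap a b = x := by
      intro hab
      ext i
      by_cases hia : i = a
      · subst hia; simp [hab]
      · by_cases hib : i = b
        · subst hib; simp [hab]
        · simp [Equiv.swap_apply_of_ne_of_ne hia hib]
    rcases (by omega : x a = 0 ∨ x a = 1) with h1 | h1 <;>
      rcases (by omega : x b = 0 ∨ x b = 1) with h2 | h2
    · simp [h1, h2, same (h1.trans h2.symm)]
    · simp [h1, h2, Equiv.swap_comm a b]
    · simp [h1, h2]
    · simp [h1, h2, same (h1.trans h2.symm)]
  have hA : ∑ a, ∑ b, (if x a = 1 then (if x b = 0 then v (x ∘ Equiv.swap a b) else 0) else 0) =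
      - (j * v x) := by
    have : ∀ a, ∑ b, (if x a = 1 then (if x b = 0 then v (x ∘ Equiv.swap a b) else 0) else 0) =
        if x a = 1 then - v x else 0 := by
      intro a
      split_ifs with ha
      · exact sum_swap_eq_neg ha (h _ (by rw [wt_update_zero ha, hx]))
      · simp
    rw [Finset.sum_congr rfl fun a _ => this a, ← Finset.sum_filter, Finset.sum_const]
    change wt x • _ = _
    rw [hx]
    simp
  have hB : ∑ a, ∑ b, (if x b = 1 then (if x a = 0 then v (x ∘ Equiv.swap b a) else 0) else 0) =
      - (j * v x) := by rw [Finset.sum_comm]; exact hA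
  have hC : ∑ a, ∑ b, (if x a = 1 then (if x b = 1 then v x else 0) else 0) = j * (j * v x) := by
    have : ∀ a, ∑ b, (if x a = 1 then (if x b = 1 then v x else 0) else 0) =
        if x a = 1 then j * v x else 0 := by
      intro a
      split_ifs with ha
      · rw [← Finset.sum_filter, Finset.sum_const]
        change wt x • _ = _
        rw [hx]
        simp
      · simp
    rw [Finset.sum_congr rfl fun a _ => this a, ← Finset.sum_filter, Finset.sum_const]
    change wt x • _ = _
    rw [hx]
    simp
  have hjn : j ≤ n := hx ▸ wt_le x
  have hD : ∑ a, ∑ b, (if x a = 0 then (if x b = 0 then v x else 0) else 0) =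
      (n - j) * ((n - j) * v x) := by
    have : ∀ a, ∑ b, (if x a = 0 then (if x b = 0 then v x else 0) else 0) =
        if x a = 0 then (n - j) * v x else 0 := by
      intro a
      split_ifs with ha
      · rw [← Finset.sum_filter, Finset.sum_const, card_filter_eq_zero, hx]
        simp [hjn]
      · simp
    rw [Finset.sum_congr rfl fun a _ => this a, ← Finset.sum_filter, Finset.sum_const,
      card_filter_eq_zero, hx]
    simp [hjn]
  rw [Finset.sum_congr rfl fun a _ => Finset.sum_congr rfl fun b _ => key a b]
  simp only [Finset.sum_add_distrib] at hA hB hC hD ⊢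
  rw [hA, hB, hC, hD, swapValue, smul_eq_mul]
  ring

/-! ### Isotypic subspaces as eigenspaces -/

theorem eigenspace_swapSum_invariant (c : ℂ) :
    SUInvariant (Module.End.eigenspace (swapSum n) c) := by
  intro g _ v hv
  rw [Module.End.mem_eigenspace_iff] at hv ⊢
  rw [swapSum_tensorRep, hv, map_smul]

/-- The eigenspace is invariant and contains a highest weight vector of V, so irreducibility puts
all of V in it. -/
theorem SUIrreducible.le_eigenspace {V : Submodule ℂ (SysPow 2 n)} (hV : SUIrreducible V)
    {l : Fin 2 → ℕ} (hl : IsHighestWeight V l) :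
    V ≤ Module.End.eigenspace (swapSum n) (swapValue n (l 1)) := by
  obtain ⟨-, w, hwV, hw0, hw⟩ := isWeight_iff.1 (isHighestWeight_iff.1 hl).1
  have hws : swapSum n w = swapValue n (l 1) • w :=
    swapSum_eq_smul hw fun y hy => hV.1.raise_eq_zero (i := wt y)
      (fun v hv x hx => hl.apply_eq_zero hV.1 hv (by omega)) hwV rfl
  rcases hV.2.2 (V ⊓ Module.End.eigenspace (swapSum n) (swapValue n (l 1))) inf_le_left
    (hV.1.inf (eigenspace_swapSum_invariant _)) with h | h
  · exact absurd ((Submodule.eq_bot_iff _).1 h w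
      ⟨hwV, Module.End.mem_eigenspace_iff.2 hws⟩) hw0
  · exact inf_eq_left.1 h

theorem isotypic_le_eigenspace (l : Fin 2 → ℕ) :
    isotypic 2 n l ≤ Module.End.eigenspace (swapSum n) (swapValue n (l 1)) :=
  sSup_le fun _ hV => hV.1.le_eigenspace hV.2

theorem isotypic_isOrtho {l l' : Fin 2 → ℕ} (hl : 2 * l 1 ≤ n) (hl' : 2 * l' 1 ≤ n)
    (h : l 1 ≠ l' 1) : isotypic 2 n l ⟂ isotypic 2 n l' :=
  ((swapSum_isSymmetric n).orthogonalFamily_eigenspaces.isOrtho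
    (fun he => h (swapValue_injOn hl hl' he))).mono (isotypic_le_eigenspace l)
      (isotypic_le_eigenspace l')

/-! ### Weyl reflection and existence of highest weights -/

theorem SUInvariant.isWeight_of_apply_ne_zero {V : Submodule ℂ (SysPow 2 n)}
    (hV : SUInvariant V) {v : SysPow 2 n} (hv : v ∈ V) {x : Fin n → Fin 2} (hx : v x ≠ 0) :
    IsWeight V ![n - wt x, wt x] := by
  by_contra h
  exact hx (hV.apply_eq_zero_of_not_isWeight h hv rfl)

theorem exists_apply_ne_zero {v : SysPow 2 n} (hv : v ≠ 0) : ∃ x, v x ≠ 0 := by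
  by_contra! h
  exact hv (PiLp.ext h)

/-- The rotation by π/2 represents the Weyl reflection: up to signs it exchanges zeros and ones. -/
theorem SUInvariant.isWeight_reflect {V : Submodule ℂ (SysPow 2 n)} (hV : SUInvariant V) {m : ℕ}
    (h : IsWeight V ![n - m, m]) : IsWeight V ![m, n - m] := by
  obtain ⟨hmn, v, hv, hv0, hvm⟩ := isWeight_iff.1 h
  simp only [Matrix.cons_val_zero, Matrix.cons_val_one] at hmn hvm
  obtain ⟨x, hx⟩ := exists_apply_ne_zero hv0
  have hxm : wt x = m := by
    by_contra hne
    exact hx (hvm x hne)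
  have hwt : wt (fun k => 1 - x k) = n - m := by rw [wt_one_sub, hxm]
  have := hV.isWeight_of_apply_ne_zero (hV _ (rotation_mem (Real.pi / 2)) v hv)
    (x := fun k => 1 - x k) ?_
  · rwa [hwt, show n - (n - m) = m by omega] at this
  · rw [tensorRep_apply, Finset.sum_eq_single x]
    · refine mul_ne_zero (Finset.prod_ne_zero_iff.2 fun k _ => ?_) hx
      rcases (by omega : x k = 0 ∨ x k = 1) with hk | hk <;> simp [hk, rotation]
    · intro y _ hy
      obtain ⟨k, hk⟩ := Function.ne_iff.1 hy
      rw [Finset.prod_eq_zero (Finset.mem_univ k), zero_mul]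
      rcases (by omega : x k = 0 ∨ x k = 1) with h1 | h1 <;>
        rcases (by omega : y k = 0 ∨ y k = 1) with h2 | h2 <;> simp_all [rotation]
    · simp

theorem SUIrreducible.exists_isHighestWeight {V : Submodule ℂ (SysPow 2 n)}
    (hV : SUIrreducible V) : ∃ m, 2 * m ≤ n ∧ IsHighestWeight V ![n - m, m] := by
  classical
  obtain ⟨v, hv, hv0⟩ := (Submodule.ne_bot_iff V).1 hV.2.1
  obtain ⟨x, hx⟩ := exists_apply_ne_zero hv0
  have hex : ∃ m, IsWeight V ![n - m, m] := ⟨_, hV.1.isWeight_of_apply_ne_zero hv hx⟩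
  have hm := Nat.find_spec hex
  have hmn := (isWeight_iff.1 hm).1
  simp only [Matrix.cons_val_zero, Matrix.cons_val_one] at hmn
  refine ⟨Nat.find hex, ?_, isHighestWeight_iff.2 ⟨hm, fun μ hμ => ?_⟩⟩
  -- The minimal number of ones cannot exceed its reflection, hence is at most n/2.
  · have h1 := hV.1.isWeight_reflect hm
    have := Nat.find_min' hex (m := n - Nat.find hex)
      (by rwa [show n - (n - Nat.find hex) = Nat.find hex by omega])
    omega
  · refine Nat.find_min' hex ?_
    have hs := (isWeight_iff.1 hμ).1
    convert hμ using 1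
    ext i
    fin_cases i
    · simp; omega
    · simp

/-- The highest weight vectors of weight `(n - j, j)`. -/
def highestWeightSpace (n j : ℕ) : Submodule ℂ (SysPow 2 n) where
  carrier := {v | v ∈ weightSpace n j ∧ ∀ y, wt y + 1 = j → raise n v y = 0}
  add_mem' := fun {a b} ha hb => ⟨add_mem ha.1 hb.1, fun y hy => by
    simp [ha.2 y hy, hb.2 y hy]⟩
  zero_mem' := ⟨zero_mem _, fun y _ => by simp⟩
  smul_mem' := fun c v hv => ⟨Submodule.smul_mem _ c hv.1, fun y hy => by simp [hv.2 y hy]⟩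

/-- Such a vector lies in the eigenspace of `swapValue n j`, a sum of irreducibles. Each of these
has some highest weight (n - m, m) with 2m ≤ n, and injectivity of the eigenvalue forces m = j. -/
theorem highestWeightSpace_le_isotypic {j : ℕ} (hj : 2 * j ≤ n) :
    highestWeightSpace n j ≤ isotypic 2 n ![n - j, j] := by
  intro v hv
  have h1 : v ∈ Module.End.eigenspace (swapSum n) (swapValue n j) :=
    Module.End.mem_eigenspace_iff.2 (swapSum_eq_smul hv.1 hv.2)
  have h2 := (eigenspace_swapSum_invariant (n := n) (swapValue n j)).le_sSup_irreducible h1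
  refine (sSup_le_sSup ?_ : _ ≤ isotypic 2 n ![n - j, j]) h2
  rintro V ⟨hV, hVe⟩
  obtain ⟨m, hm, hVm⟩ := hV.exists_isHighestWeight
  have h3 := hV.le_eigenspace hVm
  obtain ⟨u, hu, hu0⟩ := (Submodule.ne_bot_iff V).1 hV.2.1
  have h4 := (Module.End.mem_eigenspace_iff.1 (hVe hu)).symm.trans
    (Module.End.mem_eigenspace_iff.1 (h3 hu))
  have h5 := swapValue_injOn hj hm (smul_left_injective ℂ hu0 h4)
  exact ⟨hV, h5 ▸ hVm⟩

theorem isotypic_apply_eq_zero {l : Fin 2 → ℕ} {v : SysPow 2 n} (hv : v ∈ isotypic 2 n l)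
    {x : Fin n → Fin 2} (hx : wt x < l 1) : v x = 0 := by
  have h : isotypic 2 n l ≤ LinearMap.ker
      ((EuclideanSpace.proj x : SysPow 2 n →L[ℂ] ℂ) : SysPow 2 n →ₗ[ℂ] ℂ) :=
    sSup_le fun V hV v hv => LinearMap.mem_ker.2 (hV.2.apply_eq_zero hV.1.1 hv hx)
  exact h hv

/-! ### The code spaces -/

theorem mem_youngIndices {l : Fin 2 → ℕ} :
    l ∈ youngIndices 2 n ↔ l 0 + l 1 = n ∧ l 1 ≤ l 0 := by
  simp only [youngIndices, Finset.mem_filter, Finset.mem_piAntidiag, Fin.sum_univ_two]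
  constructor
  · rintro ⟨⟨h, -⟩, ha⟩
    exact ⟨h, ha (by decide)⟩
  · rintro ⟨h, h1⟩
    refine ⟨⟨h, by simp⟩, fun a b hab => ?_⟩
    fin_cases a <;> fin_cases b <;> simp_all

theorem mem_youngIndices_of_mem_youngNear {δ : ℝ} {k : Fin 2 → ℤ} {l : Fin 2 → ℕ}
    (h : l ∈ youngNear 2 n δ k) : l ∈ youngIndices 2 n := by
  simp only [youngNear, Finset.mem_filter] at h
  exact h.1

theorem codeSpace_invariant (δ : ℝ) (k : Fin 2 → ℤ) : SUInvariant (codeSpace 2 n δ k) :=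
  SUInvariant.of_iSup fun l => SUInvariant.of_iSup fun _ => isotypic_invariant l

/-- By pairwise orthogonality of the isotypic spaces, what remains of v after subtracting all its
projections is orthogonal to each of them. -/
theorem codeProj_eq (δ : ℝ) (k : Fin 2 → ℤ) :
    codeProj 2 n δ k = (codeSpace 2 n δ k).starProjection := by
  ext1 v
  symm
  have happ : codeProj 2 n δ k v =
      ∑ l ∈ youngNear 2 n δ k, (isotypic 2 n l).starProjection v := by
    simp [codeProj, isoProj]
  refine Submodule.eq_starProjection_of_mem_orthogonal ?_ ?_ |>.trans rfl
  · rw [happ]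
    exact Submodule.sum_mem _ fun l hl =>
      (le_iSup₂_of_le l hl le_rfl : isotypic 2 n l ≤ codeSpace 2 n δ k)
        (Submodule.starProjection_apply_mem _ v)
  · have : codeSpace 2 n δ k ≤ (Submodule.span ℂ {v - codeProj 2 n δ k v})ᗮ := by
      refine iSup₂_le fun l hl u hu => ?_
      rw [Submodule.mem_orthogonal_singleton_iff_inner_right, happ,
        ← Finset.add_sum_erase _ _ hl, ← sub_sub, inner_sub_left,
        Submodule.starProjection_inner_eq_zero _ _ hu, sum_inner, zero_sub, neg_eq_zero]
      refine Finset.sum_eq_zero fun l' hl' => ?_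
      have hy := mem_youngIndices.1 (mem_youngIndices_of_mem_youngNear hl)
      have hy' := mem_youngIndices.1
        (mem_youngIndices_of_mem_youngNear (Finset.mem_of_mem_erase hl'))
      refine (isotypic_isOrtho (by omega) (by omega) fun h1 => ?_).inner_eq
        (Submodule.starProjection_apply_mem _ v) hu
      refine Finset.ne_of_mem_erase hl' (funext fun i => ?_)
      fin_cases i
      · change l' 0 = l 0
        omega
      · exact h1
    rw [Submodule.mem_orthogonal']
    intro u hu
    exact (Submodule.mem_orthogonal_singleton_iff_inner_right).1 (this hu)

end Qubit

/-! ### Bures distance of pure states -/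

section General

variable {H : Type} [NormedAddCommGroup H] [InnerProductSpace ℂ H]

theorem tr_ketbra [FiniteDimensional ℂ H] (v : H) : tr (ketbra v) = (‖v‖ : ℂ) ^ 2 := by
  rw [tr, ketbra, InnerProductSpace.trace_rankOne, inner_self_eq_norm_sq_to_K]
  rfl

theorem ketbra_smul (c : ℂ) (v : H) : ketbra (c • v) = ((‖c‖ : ℂ) ^ 2) • ketbra v := by
  ext w
  simp only [ketbra, InnerProductSpace.rankOne_apply, inner_smul_left,
    smul_apply, smul_smul]
  congr 1
  rw [← Complex.conj_mul']
  ring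

theorem comp_ketbra_comp_adjoint {K : Type} [NormedAddCommGroup K] [InnerProductSpace ℂ K]
    [CompleteSpace H] [CompleteSpace K] (A : H →L[ℂ] K) (v : H) :
    A ∘L ketbra v ∘L ContinuousLinearMap.adjoint A = ketbra (A v) := by
  ext w
  simp [ketbra, ContinuousLinearMap.adjoint_inner_right]

theorem ketbra_nonneg (v : H) : 0 ≤ ketbra v :=
  (ContinuousLinearMap.nonneg_iff_isPositive _).2 (InnerProductSpace.isPositive_rankOne_self v)

variable [CompleteSpace H]

theorem sqrt_ketbra {v : H} (hv : ‖v‖ = 1) : CFC.sqrt (ketbra v) = ketbra v :=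
  CFC.sqrt_unique (InnerProductSpace.isIdempotentElem_rankOne_self hv) (ketbra_nonneg v)

/-- With A the product of the two rank-one projections, A*A is |⟨v, w⟩|² times the projection on w,
so |A| has trace |⟨v, w⟩|. -/
theorem bures_ketbra_sq [FiniteDimensional ℂ H] {v w : H} (hv : ‖v‖ = 1) (hw : ‖w‖ = 1) :
    bures (ketbra v) (ketbra w) ^ 2 = 1 - ‖⟪v, w⟫_ℂ‖ := by
  have habs : CFC.abs (ketbra v * ketbra w) = (‖⟪v, w⟫_ℂ‖ : ℂ) • ketbra w := by
    have h0 : (0 : Op H) ≤ (‖⟪v, w⟫_ℂ‖ : ℂ) • ketbra w := by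
      refine (ContinuousLinearMap.nonneg_iff_isPositive _).2 ?_
      exact (InnerProductSpace.isPositive_rankOne_self w).smul_of_nonneg (by
        exact_mod_cast norm_nonneg _)
    refine CFC.sqrt_unique ?_ h0
    have hs : ∀ u : H, star (ketbra u) = ketbra u := fun u => by
      rw [ContinuousLinearMap.star_eq_adjoint, ketbra, InnerProductSpace.adjoint_rankOne]
    rw [star_mul, hs, hs]
    ext u
    have hv' : ⟪v, v⟫_ℂ = 1 := by simp [inner_self_eq_norm_sq_to_K, hv]
    have hw' : ⟪w, w⟫_ℂ = 1 := by simp [inner_self_eq_norm_sq_to_K, hw]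
    simp only [ketbra, mul_apply_eq_comp, smul_apply,
      InnerProductSpace.rankOne_apply, map_smul, smul_smul, hv', hw']
    congr 1
    rw [← inner_conj_symm w v]
    linear_combination (⟪w, u⟫_ℂ) * (Complex.conj_mul' ⟪v, w⟫_ℂ).symm
  rw [bures, sqrt_ketbra hv, sqrt_ketbra hw, habs, Real.sq_sqrt]
  · congr 1
    rw [tr, ContinuousLinearMap.toLinearMap_smul, map_smul]
    change ((‖⟪v, w⟫_ℂ‖ : ℂ) • tr (ketbra w)).re = _
    rw [tr_ketbra, hw]
    simp
  · rw [tr, ContinuousLinearMap.toLinearMap_smul, map_smul]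
    change 0 ≤ 1 - ((‖⟪v, w⟫_ℂ‖ : ℂ) • tr (ketbra w)).re
    rw [tr_ketbra, hw]
    simpa [hv, hw] using norm_inner_le_norm (𝕜 := ℂ) v w

end General

/-! ### The error on a pure product state -/

section Code

variable {n : ℕ}

theorem sqrt_codePOVM (δ : ℝ) (k : Fin 2 → ℤ) :
    CFC.sqrt (codePOVM 2 n δ k) =
      (((Real.sqrt (latticeCount 2 (n * δ)))⁻¹ : ℝ) : ℂ) •
        (codeSpace 2 n δ k).starProjection := by
  refine CFC.sqrt_unique ?_ ?_
  · rw [smul_mul_smul_comm, Submodule.isIdempotentElem_starProjection _, codePOVM, codeProj_eq]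
    congr 1
    rw [← Complex.ofReal_mul, ← mul_inv, Real.mul_self_sqrt (Nat.cast_nonneg _)]
    simp
  · refine (ContinuousLinearMap.nonneg_iff_isPositive _).2 ?_
    refine ContinuousLinearMap.IsPositive.smul_of_nonneg ?_ (by
      exact_mod_cast inv_nonneg.2 (Real.sqrt_nonneg _))
    exact (ContinuousLinearMap.nonneg_iff_isPositive _).1
      isStarProjection_starProjection.nonneg

theorem encoder_ketbra (δ : ℝ) (k : Fin 2 → ℤ) (ψ : SysPow 2 n) :
    encoder 2 n δ k (ketbra ψ) = ((latticeCount 2 (n * δ) : ℂ)⁻¹) •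
      ketbra ((codeSpace 2 n δ k).orthogonalProjectionOnto ψ) := by
  have hC : (((Real.sqrt (latticeCount 2 (n * δ)))⁻¹ : ℝ) : ℂ) *
      (((Real.sqrt (latticeCount 2 (n * δ)))⁻¹ : ℝ) : ℂ) = (latticeCount 2 (n * δ) : ℂ)⁻¹ := by
    rw [← Complex.ofReal_mul, ← mul_inv, Real.mul_self_sqrt (Nat.cast_nonneg _)]
    simp
  have hinner : ∀ u : codeSpace 2 n δ k,
      ⟪ψ, (u : SysPow 2 n)⟫_ℂ = ⟪(codeSpace 2 n δ k).orthogonalProjectionOnto ψ, u⟫_ℂ := by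
    intro u
    rw [Submodule.coe_inner, ← Submodule.starProjection_apply,
      Submodule.inner_starProjection_left_eq_right, Submodule.starProjection_mem_subspace_eq_self]
  ext1 u
  simp only [encoder, LinearMap.coe_mk, AddHom.coe_mk, sqrt_codePOVM,
    Submodule.adjoint_subtypeL, ContinuousLinearMap.comp_apply, mul_apply_eq_comp,
    smul_apply, map_smul, ketbra, InnerProductSpace.rankOne_apply,
    Submodule.subtypeL_apply, Submodule.starProjection_mem_subspace_eq_self, hinner,
    Submodule.orthogonalProjectionOnto_starProjection_of_le le_rfl, smul_smul, ← hC]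
  congr 1
  ring

/-- The encoded state stays pure: it is the normalized Pψ, whose overlap with ψ is ‖Pψ‖. -/
theorem error_term_ketbra (δ : ℝ) (k : Fin 2 → ℤ) {ψ : SysPow 2 n} (hψ : ‖ψ‖ = 1) :
    (tr (encoder 2 n δ k (ketbra ψ))).re *
      bures (ketbra ψ) (decoder 2 n δ k ((tr (encoder 2 n δ k (ketbra ψ)))⁻¹ •
        encoder 2 n δ k (ketbra ψ))) ^ 2 =
    (latticeCount 2 (n * δ) : ℝ)⁻¹ * ‖(codeSpace 2 n δ k).starProjection ψ‖ ^ 2 *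
      (1 - ‖(codeSpace 2 n δ k).starProjection ψ‖) := by
  set P := (codeSpace 2 n δ k).starProjection with hP
  set C : ℝ := (latticeCount 2 (n * δ) : ℝ) with hC
  have hnorm : ‖(codeSpace 2 n δ k).orthogonalProjectionOnto ψ‖ = ‖P ψ‖ := rfl
  have htr : tr (encoder 2 n δ k (ketbra ψ)) = ((C⁻¹ * ‖P ψ‖ ^ 2 : ℝ) : ℂ) := by
    rw [encoder_ketbra, tr, ContinuousLinearMap.toLinearMap_smul, map_smul]
    change _ • tr (ketbra _) = _
    rw [tr_ketbra, hnorm]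
    simp [hC]
  have hdec : decoder 2 n δ k (encoder 2 n δ k (ketbra ψ)) = ((C⁻¹ : ℝ) : ℂ) • ketbra (P ψ) := by
    rw [encoder_ketbra, map_smul]
    congr 1
    · simp [hC]
    · exact comp_ketbra_comp_adjoint (H := codeSpace 2 n δ k) (K := SysPow 2 n) _ _
  rw [map_smul, hdec, htr, Complex.ofReal_re]
  -- In the degenerate cases both sides vanish: for `C = 0` through the convention `0⁻¹ = 0`, for Pψ
  -- = 0 through the squared norm.
  by_cases h0 : C = 0
  · simp [h0]
  by_cases hq : ‖P ψ‖ = 0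
  · simp [hq]
  have hstate : ((C⁻¹ * ‖P ψ‖ ^ 2 : ℝ) : ℂ)⁻¹ • ((C⁻¹ : ℝ) : ℂ) • ketbra (P ψ) =
      ketbra (((‖P ψ‖⁻¹ : ℝ) : ℂ) • P ψ) := by
    rw [ketbra_smul, smul_smul]
    congr 1
    rw [Complex.norm_real, norm_inv, norm_norm]
    have h1 : (C : ℂ) ≠ 0 := by exact_mod_cast h0
    have h2 : (‖P ψ‖ : ℂ) ≠ 0 := by exact_mod_cast hq
    push_cast
    field_simp
  have hinner : ‖⟪ψ, ((‖P ψ‖⁻¹ : ℝ) : ℂ) • P ψ⟫_ℂ‖ = ‖P ψ‖ := by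
    have h1 : ⟪ψ, P ψ⟫_ℂ = (‖P ψ‖ : ℂ) ^ 2 := by
      have h2 : P (P ψ) = P ψ :=
        Submodule.starProjection_eq_self_iff.2 (Submodule.starProjection_apply_mem _ ψ)
      rw [← h2, ← Submodule.inner_starProjection_left_eq_right, inner_self_eq_norm_sq_to_K, h2]
      rfl
    rw [inner_smul_right, h1, norm_mul, Complex.norm_real, norm_inv, norm_norm, norm_pow,
      Complex.norm_real, norm_norm]
    field_simp
  rw [hstate, bures_ketbra_sq hψ, hinner]
  rw [norm_smul, Complex.norm_real, norm_inv, norm_norm, inv_mul_cancel₀ hq]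

end Code

/-! ### Product states -/

theorem tensorOp_ketbra {d n : ℕ} (u : Fin n → Sys d) :
    tensorOp (fun k => ketbra (u k)) =
      ketbra (WithLp.toLp 2 fun x : Fin n → Fin d => ∏ k, u k (x k)) := by
  ext v x
  simp only [tensorOp, Matrix.ofLp_toEuclideanCLM, Matrix.mulVec, dotProduct, Matrix.of_apply,
    ketbra, InnerProductSpace.rankOne_apply, PiLp.smul_apply, PiLp.inner_apply, smul_eq_mul,
    Finset.sum_mul]
  refine Finset.sum_congr rfl fun y _ => ?_
  simp [map_prod, Finset.prod_mul_distrib]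
  ring

/-- A phase does not change `ketbra`, so the second basis vector can be multiplied by the conjugate
of the determinant to make the matrix special. -/
theorem exists_specialUnitary_ketbra_eq (e : OrthonormalBasis (Fin 2) ℂ (Sys 2)) :
    ∃ g ∈ Matrix.specialUnitaryGroup (Fin 2) ℂ,
      ∀ i, ketbra (e i) = ketbra (WithLp.toLp 2 fun a => g a i : Sys 2) := by
  have unit : ∀ u : Fin 2 → Sys 2, Orthonormal ℂ u →
      Matrix.of (fun a i => u i a) ∈ Matrix.unitaryGroup (Fin 2) ℂ := by
    intro u hu
    rw [Matrix.mem_unitaryGroup_iff']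
    ext i j
    have := (orthonormal_iff_ite.1 hu) i j
    rw [Matrix.one_apply, ← this]
    simp [Matrix.mul_apply, PiLp.inner_apply, Matrix.star_apply, mul_comm]
  set D := (Matrix.of fun a i => e i a).det with hD
  have hD1 : D * star D = 1 := by
    have := (Matrix.det_of_mem_unitary (unit e e.orthonormal)).2
    exact this
  have hDn : ‖star D‖ = 1 := by
    have h : ‖D‖ ^ 2 = 1 := by
      have := congrArg norm hD1
      rw [norm_mul, norm_star, norm_one] at this
      rw [sq, this]
    rw [norm_star]
    exact (pow_eq_one_iff_of_nonneg (norm_nonneg _) two_ne_zero).1 h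
  have hDD : (starRingEnd ℂ) D * D = 1 := by rw [mul_comm]; exact hD1
  set c : Fin 2 → ℂ := ![1, star D] with hc
  have hcn : ∀ i, ‖c i‖ = 1 := by
    intro i
    fin_cases i
    · simp [hc]
    · simpa [hc] using hDn
  refine ⟨Matrix.of fun a i => (c i • e i) a, ?_, fun i => ?_⟩
  · rw [Matrix.mem_specialUnitaryGroup_iff]
    refine ⟨unit (fun i => c i • e i) ⟨fun i => ?_, fun i j hij => ?_⟩, ?_⟩
    · rw [norm_smul, hcn, e.orthonormal.1, one_mul]
    · change ⟪c i • e i, c j • e j⟫_ℂ = 0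
      rw [inner_smul_left, inner_smul_right, e.orthonormal.2 hij, mul_zero, mul_zero]
    · rw [Matrix.det_fin_two] at hD ⊢
      simp only [Matrix.of_apply] at hD
      simp [hc]
      linear_combination (starRingEnd ℂ D) * (-hD) + hDD
  · change _ = ketbra (c i • e i)
    rw [ketbra_smul, hcn]
    simp

section Qubit

variable {n : ℕ}

theorem tensorOp_ketbra_eq (g : Matrix (Fin 2) (Fin 2) ℂ) (s : Fin n → Fin 2) :
    tensorOp (fun k => ketbra (WithLp.toLp 2 fun a => g a (s k) : Sys 2)) =
      ketbra (tensorRep n g (EuclideanSpace.single s 1)) := by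
  rw [tensorOp_ketbra]
  congr 1
  ext x
  rw [tensorRep_single]

/-! ### Counting strings and highest weight vectors -/

theorem card_filter_wt (n j : ℕ) :
    (Finset.univ.filter fun x : Fin n → Fin 2 => wt x = j).card = n.choose j := by
  have h : (Finset.powersetCard j (Finset.univ : Finset (Fin n))).card = n.choose j := by simp
  rw [← h]
  refine Finset.card_bij (fun x _ => Finset.univ.filter fun k => x k = 1) ?_ ?_ ?_
  · intro x hx
    exact Finset.mem_powersetCard.2 ⟨Finset.subset_univ _, (Finset.mem_filter.1 hx).2⟩
  · intro x _ y _ hxy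
    funext k
    have := Finset.ext_iff.1 hxy k
    simp only [Finset.mem_filter, Finset.mem_univ, true_and] at this
    omega
  · intro t ht
    have h1 : (Finset.univ.filter fun k => (if k ∈ t then (1 : Fin 2) else 0) = 1) = t := by
      ext k
      simp
    refine ⟨fun k => if k ∈ t then 1 else 0, Finset.mem_filter.2 ⟨Finset.mem_univ _, ?_⟩, h1⟩
    rw [wt, h1]
    exact (Finset.mem_powersetCard.1 ht).2

/-- Rank-nullity: the space is cut out by one equation per string without j + 1 ones and one per
string with j ones. -/
theorem choose_le_finrank_highestWeightSpace (n j : ℕ) :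
    n.choose (j + 1) ≤ Module.finrank ℂ (highestWeightSpace n (j + 1)) + n.choose j := by
  set A := {y : Fin n → Fin 2 // wt y = j}
  set B := {x : Fin n → Fin 2 // ¬ wt x = j + 1}
  let L : SysPow 2 n →ₗ[ℂ] (A → ℂ) × (B → ℂ) :=
    LinearMap.prod (LinearMap.pi fun y : A => LinearMap.proj y.1 ∘ₗ raise n)
      (LinearMap.pi fun x : B => ((EuclideanSpace.proj x.1 : SysPow 2 n →L[ℂ] ℂ) :
        SysPow 2 n →ₗ[ℂ] ℂ))
  have hker : LinearMap.ker L ≤ highestWeightSpace n (j + 1) := by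
    intro v hv
    have h1 : L v = 0 := hv
    refine ⟨fun x hx => congrFun (congrArg Prod.snd h1) ⟨x, hx⟩, fun y hy => ?_⟩
    exact congrFun (congrArg Prod.fst h1) ⟨y, by omega⟩
  have h1 := L.finrank_range_add_finrank_ker
  have h2 := Submodule.finrank_mono hker
  have h3 := (LinearMap.range L).finrank_le
  rw [Module.finrank_prod, Module.finrank_fintype_fun_eq_card,
    Module.finrank_fintype_fun_eq_card] at h3
  have hA : Fintype.card A = n.choose j := by
    rw [Fintype.card_subtype, card_filter_wt]
  have hB : Fintype.card B + n.choose (j + 1) = Fintype.card (Fin n → Fin 2) := by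
    rw [Fintype.card_subtype, ← card_filter_wt, add_comm, Finset.card_filter_add_card_filter_not,
      Finset.card_univ]
  rw [finrank_euclideanSpace] at h1
  omega

/-- The ratio C(n, j)/C(n, j+1) is (j + 1)/(n - j), so the relative gap is (n - 2j - 1)/(n - j),
whose numerator is at least 1. -/
theorem choose_succ_le {n j : ℕ} (hj : 2 * (j + 1) ≤ n) :
    n.choose (j + 1) ≤ (n + 1) * (n.choose (j + 1) - n.choose j) := by
  have h1 := Nat.choose_succ_right_eq n j
  have h2 : n.choose j ≤ n.choose (j + 1) := Nat.choose_le_succ_of_lt_half_left (by omega)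
  obtain ⟨m, hm⟩ := Nat.exists_eq_add_of_le hj
  obtain ⟨c, hc⟩ := Nat.exists_eq_add_of_le h2
  rw [hc, Nat.add_sub_cancel_left]
  rw [hc, show n - j = j + 2 + m by omega] at h1
  subst hm
  nlinarith

/-! ### Projections of basis strings -/

/-- Both sides are the trace of the projection. -/
theorem sum_norm_sq_starProjection (K : Submodule ℂ (SysPow 2 n)) :
    ∑ s, ‖K.starProjection (EuclideanSpace.single s 1)‖ ^ 2 = Module.finrank ℂ K := by
  have h1 : LinearMap.trace ℂ _ (K.starProjection : SysPow 2 n →ₗ[ℂ] SysPow 2 n) =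
      (Module.finrank ℂ K : ℂ) :=
    LinearMap.IsProj.trace ⟨fun x => K.starProjection_apply_mem x,
      fun x hx => Submodule.starProjection_eq_self_iff.2 hx⟩
  rw [LinearMap.trace_eq_sum_inner _ (EuclideanSpace.basisFun (Fin n → Fin 2) ℂ)] at h1
  have h2 := congrArg Complex.re h1
  rw [Complex.re_sum, Complex.natCast_re] at h2
  rw [← h2]
  refine Finset.sum_congr rfl fun s _ => ?_
  have h3 := K.re_inner_starProjection_eq_normSq (EuclideanSpace.single s 1 : SysPow 2 n)
  rw [EuclideanSpace.basisFun_apply, ← inner_conj_symm]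
  exact h3.symm.trans (Complex.conj_re _).symm

/-- The projection onto the highest weight vectors kills every string without j + 1 ones, so its
whole trace comes from the strings summed here; passing to the larger U only increases the norms. -/
theorem choose_le_sum_norm_sq {j : ℕ} (hj : 2 * (j + 1) ≤ n) {U : Submodule ℂ (SysPow 2 n)}
    (hU : highestWeightSpace n (j + 1) ≤ U) :
    (n.choose (j + 1) : ℝ) ≤ (n + 1) * ∑ s ∈ Finset.univ.filter fun s => wt s = j + 1,
      ‖U.starProjection (EuclideanSpace.single s 1)‖ ^ 2 := by
  set K := highestWeightSpace n (j + 1) with hK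
  have h1 : ∑ s, ‖K.starProjection (EuclideanSpace.single s 1)‖ ^ 2 ≤
      ∑ s ∈ Finset.univ.filter fun s => wt s = j + 1,
        ‖U.starProjection (EuclideanSpace.single s 1)‖ ^ 2 := by
    rw [Finset.sum_filter]
    refine Finset.sum_le_sum fun s _ => ?_
    split_ifs with hs
    · have h := DFunLike.congr_fun (Submodule.starProjection_comp_starProjection_of_le hU)
        (EuclideanSpace.single s 1)
      rw [← h]
      exact pow_le_pow_left₀ (norm_nonneg _) (Submodule.norm_starProjection_apply_le _ _) 2
    · rw [(Submodule.starProjection_apply_eq_zero_iff K).2, norm_zero]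
      · norm_num
      · rw [Submodule.mem_orthogonal]
        intro v hv
        simp [EuclideanSpace.inner_single_right, hv.1 s hs]
  rw [sum_norm_sq_starProjection] at h1
  have h2 : n.choose (j + 1) ≤ (n + 1) * Module.finrank ℂ K :=
    (choose_succ_le hj).trans (Nat.mul_le_mul_left _ (by
      rw [hK, tsub_le_iff_right]
      exact choose_le_finrank_highestWeightSpace n j))
  have h3 : (n.choose (j + 1) : ℝ) ≤ (n + 1) * Module.finrank ℂ K := by exact_mod_cast h2
  exact h3.trans (mul_le_mul_of_nonneg_left h1 (by positivity))

/-- A basis vector keeps a polynomially small part outside an invariant subspace that has no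
component of the next lower weight. -/
theorem norm_sq_starProjection_single_le {j : ℕ} {U : Submodule ℂ (SysPow 2 n)}
    (hU : SUInvariant U) (hUj : ∀ v ∈ U, ∀ x, wt x = j → v x = 0) {s : Fin n → Fin 2}
    (hs : wt s = j + 1) :
    (1 : ℝ) ≤ n ^ 2 * (1 - ‖U.starProjection (EuclideanSpace.single s 1)‖ ^ 2) := by
  obtain ⟨k₀, hk₀⟩ : ∃ k, s k = 1 := by
    have : 0 < (Finset.univ.filter fun k => s k = 1).card := by
      change 0 < wt s
      omega
    obtain ⟨k, hk⟩ := Finset.card_pos.1 this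
    exact ⟨k, (Finset.mem_filter.1 hk).2⟩
  set y := Function.update s k₀ 0 with hy
  have hyj : wt y = j := by
    have := wt_update_zero hk₀
    rw [← hy] at this
    omega
  -- `u` represents the functional reading `raise` at y. It has overlap 1 with the string s and 0
  -- with the projection of s to U, so Cauchy–Schwarz bounds the part of s outside U from below; ‖u‖
  -- ≤ n since u is a sum of at most n unit vectors.
  set u : SysPow 2 n := ∑ k, if y k = 0 then EuclideanSpace.single (Function.update y k 1) 1 else 0
    with hu
  have hinner : ∀ v : SysPow 2 n, ⟪u, v⟫_ℂ = raise n v y := by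
    intro v
    rw [hu, sum_inner, raise_apply]
    refine Finset.sum_congr rfl fun k _ => ?_
    split_ifs
    · simp [EuclideanSpace.inner_single_left]
    · simp
  have hun : ‖u‖ ≤ n := by
    refine (norm_sum_le _ _).trans ?_
    refine (Finset.sum_le_sum (g := fun _ => (1 : ℝ)) fun k _ => ?_).trans (by simp)
    split_ifs <;> simp
  set ψ : SysPow 2 n := EuclideanSpace.single s 1 with hψ
  have h1 : ⟪u, ψ⟫_ℂ = 1 := by
    rw [hinner, raise_apply, Finset.sum_eq_single k₀]
    · have : Function.update y k₀ 1 = s := by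
        rw [hy, Function.update_idem, ← hk₀, Function.update_eq_self]
      have hy0 : y k₀ = 0 := by simp [hy]
      rw [if_pos hy0, this]
      simp [hψ]
    · intro k _ hk
      split_ifs with hyk
      · have : Function.update y k 1 ≠ s := by
          intro h
          have := congrFun h k₀
          simp [hy, hk.symm, hk₀] at this
        simp [hψ, this]
      · rfl
    · simp
  have h2 : ⟪u, U.starProjection ψ⟫_ℂ = 0 := by
    rw [hinner]
    exact hU.raise_eq_zero hUj (U.starProjection_apply_mem ψ) hyj
  have h3 : (1 : ℝ) ≤ n * ‖Uᗮ.starProjection ψ‖ := by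
    have h4 : ⟪u, Uᗮ.starProjection ψ⟫_ℂ = 1 := by
      rw [Submodule.starProjection_orthogonal_val, inner_sub_right, h1, h2, sub_zero]
    calc (1 : ℝ) = ‖⟪u, Uᗮ.starProjection ψ⟫_ℂ‖ := by rw [h4, norm_one]
      _ ≤ ‖u‖ * ‖Uᗮ.starProjection ψ‖ := norm_inner_le_norm _ _
      _ ≤ n * ‖Uᗮ.starProjection ψ‖ := by gcongr
  have h5 := Submodule.norm_sq_eq_add_norm_sq_starProjection ψ U
  have h6 : ‖ψ‖ = 1 := by simp [hψ]
  rw [h6] at h5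
  rw [show 1 - ‖U.starProjection ψ‖ ^ 2 = ‖Uᗮ.starProjection ψ‖ ^ 2 by linarith, ← mul_pow]
  exact one_le_pow₀ h3

/-! ### The data set -/

/-- The two coordinate differences are opposite, whence the factor 2. -/
theorem mem_youngNear_iff {δ : ℝ} (hδ : 0 ≤ δ) {k : Fin 2 → ℤ} (hk : k 0 + k 1 = n)
    {l : Fin 2 → ℕ} :
    l ∈ youngNear 2 n δ k ↔ l ∈ youngIndices 2 n ∧
      2 * ((l 1 : ℝ) - k 1) ^ 2 ≤ (n * δ) ^ 2 := by
  simp only [youngNear, Finset.mem_filter]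
  refine and_congr_right fun hl => ?_
  have h1 := (mem_youngIndices.1 hl).1
  have h2 : (l 0 : ℝ) - k 0 = -((l 1 : ℝ) - k 1) := by
    have h3 : (l 0 : ℝ) + l 1 = n := by exact_mod_cast h1
    have h4 : (k 0 : ℝ) + k 1 = n := by exact_mod_cast hk
    linarith
  rw [EuclideanSpace.norm_eq, Fin.sum_univ_two, Real.sqrt_le_iff]
  simp only [h2, norm_neg, Real.norm_eq_abs, sq_abs]
  constructor
  · rintro ⟨-, h⟩
    linarith
  · intro h
    exact ⟨by positivity, by linarith⟩

theorem exists_data {δ : ℝ} (hδ : 0 ≤ δ) {j : ℕ} (hj : 2 * j ≤ n) :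
    ∃ k ∈ dataSet 2 n δ, ![n - j, j] ∈ youngNear 2 n δ k ∧
      ∀ l ∈ youngNear 2 n δ k, j ≤ l 1 := by
  -- R is the largest integer with 2R² ≤ (nδ)², the reach of the window in the second coordinate;
  -- centring at j + R makes j the smallest second entry in it.
  set R : ℕ := ⌊n * δ / Real.sqrt 2⌋₊ with hR
  have hs2 : (0 : ℝ) < Real.sqrt 2 := by positivity
  have hsq : Real.sqrt 2 ^ 2 = 2 := Real.sq_sqrt (by norm_num)
  have h0 : (0 : ℝ) ≤ n * δ := by positivity
  have hR1 : (R : ℝ) * Real.sqrt 2 ≤ n * δ :=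
    (le_div_iff₀ hs2).1 (Nat.floor_le (by positivity))
  have hR2 : n * δ < ((R : ℝ) + 1) * Real.sqrt 2 := (div_lt_iff₀ hs2).1 (Nat.lt_floor_add_one _)
  have hR3 : 2 * (R : ℝ) ^ 2 ≤ (n * δ) ^ 2 := by
    have := pow_le_pow_left₀ (by positivity) hR1 2
    rw [mul_pow, hsq] at this
    linarith
  have hR4 : (n * δ) ^ 2 < 2 * ((R : ℝ) + 1) ^ 2 := by
    have := pow_lt_pow_left₀ hR2 h0 two_ne_zero
    rw [mul_pow _ (Real.sqrt 2), hsq] at this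
    linarith
  set k : Fin 2 → ℤ := ![(n : ℤ) - (j + R), j + R] with hk
  have hks : k 0 + k 1 = n := by simp [hk]
  have hmem : ![n - j, j] ∈ youngNear 2 n δ k := by
    rw [mem_youngNear_iff hδ hks, mem_youngIndices]
    refine ⟨⟨by simp; omega, by simp; omega⟩, ?_⟩
    simp only [hk, Matrix.cons_val_one, Matrix.cons_val_fin_one]
    push_cast
    calc 2 * ((j : ℝ) - (j + R)) ^ 2 = 2 * (R : ℝ) ^ 2 := by ring
      _ ≤ _ := hR3
  refine ⟨k, ⟨by rw [Fin.sum_univ_two, hks], _, hmem⟩, hmem, fun l hl => ?_⟩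
  have h1 := ((mem_youngNear_iff hδ hks).1 hl).2
  by_contra! hlt
  have h2 : (l 1 : ℝ) + 1 ≤ j := by exact_mod_cast hlt
  have hk1 : (k 1 : ℝ) = j + R := by simp [hk]
  rw [hk1] at h1
  have h3 : ((R : ℝ) + 1) ^ 2 ≤ ((l 1 : ℝ) - (j + R)) ^ 2 := by
    rw [← neg_sq ((l 1 : ℝ) - (j + R))]
    exact pow_le_pow_left₀ (by positivity) (by linarith) 2
  linarith

theorem latticeCount_le {x : ℝ} (hx : x ≤ n) : latticeCount 2 x ≤ 2 * n + 1 := by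
  have hsub : {k : Fin 2 → ℤ | ‖WithLp.toLp 2 (fun i => (k i : ℝ))‖ ≤ x ∧ ∑ i, k i = 0} ⊆
      ((Finset.Icc (-(n : ℤ)) n).image fun t => ![t, -t] : Finset (Fin 2 → ℤ)) := by
    rintro k ⟨hk, hs⟩
    rw [Fin.sum_univ_two] at hs
    have h1 := ((PiLp.norm_apply_le (WithLp.toLp 2 fun i => (k i : ℝ)) 0).trans hk).trans hx
    have h2 : |k 0| ≤ n := by
      change |(k 0 : ℝ)| ≤ n at h1
      exact_mod_cast h1
    rw [abs_le] at h2
    simp only [Finset.coe_image, Set.mem_image, Finset.coe_Icc, Set.mem_Icc]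
    refine ⟨k 0, h2, ?_⟩
    ext i
    fin_cases i
    · rfl
    · simp; omega
  refine (Set.ncard_le_ncard hsub (Finset.finite_toSet _)).trans ?_
  rw [Set.ncard_coe_finset]
  refine Finset.card_image_le.trans ?_
  rw [Int.card_Icc]
  omega

theorem latticeCount_pos {x : ℝ} (hx : 0 ≤ x) : 0 < latticeCount 2 x := by
  have hfin : {k : Fin 2 → ℤ | ‖WithLp.toLp 2 (fun i => (k i : ℝ))‖ ≤ x ∧
      ∑ i, k i = 0}.Finite := by
    refine (Set.finite_Icc (fun _ : Fin 2 => -⌈x⌉) fun _ => ⌈x⌉).subset ?_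
    rintro k ⟨hk, -⟩
    have key : ∀ i, |k i| ≤ ⌈x⌉ := fun i => by
      have h1 := (PiLp.norm_apply_le (WithLp.toLp 2 fun i => (k i : ℝ)) i).trans hk
      change |(k i : ℝ)| ≤ x at h1
      exact_mod_cast h1.trans (Int.le_ceil x)
    exact ⟨fun i => (abs_le.1 (key i)).1, fun i => (abs_le.1 (key i)).2⟩
  refine (Set.ncard_pos hfin).2 ⟨0, ?_, by simp⟩
  simpa [EuclideanSpace.norm_eq] using hx

theorem card_dataSet_le {δ : ℝ} (hδ : 0 ≤ δ) (hδ1 : δ < 1) :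
    Fintype.card (dataSet 2 n δ) ≤ 3 * n + 1 := by
  have hsub : dataSet 2 n δ ⊆
      ((Finset.Icc (-(n : ℤ)) (2 * n)).image fun t => ![(n : ℤ) - t, t] : Finset (Fin 2 → ℤ)) := by
    rintro k ⟨hk, l, hl⟩
    rw [Fin.sum_univ_two] at hk
    obtain ⟨h1, h2⟩ := (mem_youngNear_iff hδ hk).1 hl
    have h3 := (mem_youngIndices.1 h1).1
    have h4 : (n * δ) ^ 2 ≤ (n : ℝ) ^ 2 :=
      pow_le_pow_left₀ (by positivity) (mul_le_of_le_one_right (by positivity) hδ1.le) 2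
    have h5 : ((l 1 : ℝ) - k 1) ^ 2 ≤ (n : ℝ) ^ 2 := by
      nlinarith [sq_nonneg ((l 1 : ℝ) - k 1)]
    have h6 : |(l 1 : ℤ) - k 1| ≤ n := by
      have := abs_le_of_sq_le_sq h5 (by positivity)
      exact_mod_cast this
    rw [abs_le] at h6
    simp only [Finset.coe_image, Set.mem_image, Finset.coe_Icc, Set.mem_Icc]
    refine ⟨k 1, by omega, ?_⟩
    ext i
    fin_cases i
    · simp; omega
    · rfl
  rw [← Nat.card_eq_fintype_card, Nat.card_coe_set_eq]
  refine (Set.ncard_le_ncard hsub (Finset.finite_toSet _)).trans ?_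
  rw [Set.ncard_coe_finset]
  refine Finset.card_image_le.trans ?_
  rw [Int.card_Icc]
  omega

/-! ### Errors on basis strings -/

/-- The contribution of the datum `k` to the error on the basis string `s`. -/
def dataError (n : ℕ) (δ : ℝ) (s : Fin n → Fin 2) (k : Fin 2 → ℤ) : ℝ :=
  (latticeCount 2 (n * δ) : ℝ)⁻¹ *
    ‖(codeSpace 2 n δ k).starProjection (EuclideanSpace.single s 1)‖ ^ 2 *
      (1 - ‖(codeSpace 2 n δ k).starProjection (EuclideanSpace.single s 1)‖)

/-- The error of the code `(E^{δ,n}, D^{δ,n})` on the basis string `s`. -/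
def stringError (n : ℕ) (δ : ℝ) (s : Fin n → Fin 2) : ℝ :=
  ∑ k : dataSet 2 n δ, dataError n δ s k.1

theorem norm_starProjection_single_le (U : Submodule ℂ (SysPow 2 n)) (s : Fin n → Fin 2) :
    ‖U.starProjection (EuclideanSpace.single s 1)‖ ≤ 1 :=
  (Submodule.norm_starProjection_apply_le _ _).trans (by simp)

theorem dataError_nonneg (δ : ℝ) (s : Fin n → Fin 2) (k : Fin 2 → ℤ) : 0 ≤ dataError n δ s k :=
  mul_nonneg (by positivity) (sub_nonneg.2 (norm_starProjection_single_le _ s))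

theorem dataError_le_one {δ : ℝ} (hδ : 0 ≤ δ) (s : Fin n → Fin 2) (k : Fin 2 → ℤ) :
    dataError n δ s k ≤ 1 := by
  have hC : (1 : ℝ) ≤ latticeCount 2 (n * δ) := by
    exact_mod_cast latticeCount_pos (x := n * δ) (by positivity)
  have h1 := norm_starProjection_single_le (codeSpace 2 n δ k) s
  have h0 := norm_nonneg ((codeSpace 2 n δ k).starProjection (EuclideanSpace.single s 1))
  exact mul_le_one₀ (mul_le_one₀ (inv_le_one_of_one_le₀ hC) (by positivity)
    (pow_le_one₀ h0 h1)) (by linarith) (by linarith)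

theorem dataError_le_stringError {δ : ℝ} {k : Fin 2 → ℤ} (hk : k ∈ dataSet 2 n δ)
    (s : Fin n → Fin 2) : dataError n δ s k ≤ stringError n δ s := by
  have h : ∀ k ∈ (Finset.univ : Finset (dataSet 2 n δ)), 0 ≤ dataError n δ s k.1 :=
    fun k _ => dataError_nonneg δ s k.1
  have h1 := Finset.single_le_sum h (Finset.mem_univ (⟨k, hk⟩ : dataSet 2 n δ))
  unfold stringError
  exact h1

theorem stringError_nonneg (δ : ℝ) (s : Fin n → Fin 2) : 0 ≤ stringError n δ s :=
  Finset.sum_nonneg fun k _ => dataError_nonneg δ s k.1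

theorem stringError_le {δ : ℝ} (hδ : 0 ≤ δ) (hδ1 : δ < 1) (s : Fin n → Fin 2) :
    stringError n δ s ≤ 3 * n + 1 := by
  calc stringError n δ s ≤ ∑ _k : dataSet 2 n δ, (1 : ℝ) :=
        Finset.sum_le_sum fun k _ => dataError_le_one hδ s k.1
    _ = Fintype.card (dataSet 2 n δ) := by simp
    _ ≤ 3 * n + 1 := by exact_mod_cast card_dataSet_le hδ hδ1

/-- Since 1 - q² ≤ 2(1 - q), the hypothesis bounds 1 - q below by 1/(2n²), and C costs at most a
factor 2n + 1. -/
theorem sq_le_mul_error {q C : ℝ} (h1 : q ≤ 1) (hC1 : 1 ≤ C) (hC2 : C ≤ 2 * n + 1)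
    (h : 1 ≤ n ^ 2 * (1 - q ^ 2)) :
    q ^ 2 ≤ 2 * n ^ 2 * (2 * n + 1) * (C⁻¹ * q ^ 2 * (1 - q)) := by
  have h5 : (1 : ℝ) ≤ 2 * n ^ 2 * (1 - q) := by
    have : 1 - q ^ 2 ≤ 2 * (1 - q) := by nlinarith
    calc (1 : ℝ) ≤ n ^ 2 * (1 - q ^ 2) := h
      _ ≤ n ^ 2 * (2 * (1 - q)) := by gcongr
      _ = _ := by ring
  have h6 : 1 ≤ (2 * n + 1) * C⁻¹ := by
    rw [← div_eq_mul_inv, one_le_div (by linarith)]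
    exact hC2
  calc q ^ 2 = q ^ 2 * (1 * 1) := by ring
    _ ≤ q ^ 2 * (((2 * n + 1) * C⁻¹) * (2 * n ^ 2 * (1 - q))) := by gcongr
    _ = _ := by ring

theorem codeSpace_apply_eq_zero {δ : ℝ} {k : Fin 2 → ℤ} {j : ℕ}
    (h : ∀ l ∈ youngNear 2 n δ k, j < l 1) {v : SysPow 2 n} (hv : v ∈ codeSpace 2 n δ k)
    {x : Fin n → Fin 2} (hx : wt x = j) : v x = 0 := by
  have hle : codeSpace 2 n δ k ≤ LinearMap.ker
      ((EuclideanSpace.proj x : SysPow 2 n →L[ℂ] ℂ) : SysPow 2 n →ₗ[ℂ] ℂ) :=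
    iSup₂_le fun l hl v hv => LinearMap.mem_ker.2
      (isotypic_apply_eq_zero hv (hx.trans_lt (h l hl)))
  exact hle hv

/-- One datum suffices, the same for all strings with j + 1 ones: every contribution is nonnegative,
and for the window starting at j + 1 the bounds on q² and on 1 - q² both apply. -/
theorem choose_le_sum_stringError {δ : ℝ} (hδ : 0 ≤ δ) (hδ1 : δ < 1) {j : ℕ}
    (hj : 2 * (j + 1) ≤ n) :
    (n.choose (j + 1) : ℝ) ≤ ((n + 1) * (2 * n ^ 2 * (2 * n + 1))) *
      ∑ s ∈ Finset.univ.filter fun s => wt s = j + 1, stringError n δ s := by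
  obtain ⟨k, hk, hmem, hnear⟩ := exists_data hδ hj
  have hle : highestWeightSpace n (j + 1) ≤ codeSpace 2 n δ k :=
    (highestWeightSpace_le_isotypic hj).trans
      (le_iSup₂_of_le (f := fun l _ => isotypic 2 n l) _ hmem le_rfl)
  have hC1 : (1 : ℝ) ≤ latticeCount 2 (n * δ) := by
    exact_mod_cast latticeCount_pos (x := n * δ) (by positivity)
  have hC2 : (latticeCount 2 (n * δ) : ℝ) ≤ 2 * n + 1 := by
    exact_mod_cast latticeCount_le (n := n) (x := n * δ)
      (mul_le_of_le_one_right (by positivity) hδ1.le)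
  refine (choose_le_sum_norm_sq hj hle).trans ?_
  rw [mul_assoc]
  refine mul_le_mul_of_nonneg_left ?_ (by positivity : (0 : ℝ) ≤ n + 1)
  rw [Finset.mul_sum]
  refine Finset.sum_le_sum fun s hs => ?_
  have h1 := norm_sq_starProjection_single_le (codeSpace_invariant δ k)
    (fun v hv x hx => codeSpace_apply_eq_zero hnear hv hx) (Finset.mem_filter.1 hs).2
  exact (sq_le_mul_error (norm_starProjection_single_le _ s) hC1 hC2 h1).trans
    (mul_le_mul_of_nonneg_left (dataError_le_stringError hk s) (by positivity))

theorem tensorRep_single_error (δ : ℝ) {g : Matrix (Fin 2) (Fin 2) ℂ}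
    (hg : g ∈ Matrix.specialUnitaryGroup (Fin 2) ℂ) (s : Fin n → Fin 2) :
    ∑ k : dataSet 2 n δ,
      (tr (encoder 2 n δ k.1 (ketbra (tensorRep n g (EuclideanSpace.single s 1))))).re *
        bures (ketbra (tensorRep n g (EuclideanSpace.single s 1)))
          (decoder 2 n δ k.1 (
            (tr (encoder 2 n δ k.1 (ketbra (tensorRep n g (EuclideanSpace.single s 1)))))⁻¹ •
              encoder 2 n δ k.1 (ketbra (tensorRep n g (EuclideanSpace.single s 1))))) ^ 2 =
      stringError n δ s := by
  refine Finset.sum_congr rfl fun k _ => ?_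
  rw [error_term_ketbra δ k.1 (by rw [norm_tensorRep hg]; simp),
    (codeSpace_invariant δ k.1).starProjection_comm hg, norm_tensorRep hg, dataError]

/-! ### Binomial sums -/

/-- As b ≤ a, each binomial term above n/2 is at most its mirror image under j ↦ n - j, so the lower
half carries mass at least 1/2. The term j = 0 is aⁿ; it is removed because the error bound needs at
least one 1 in the string. -/
theorem half_sub_pow_le_sum_choose {a b : ℝ} (ha : 0 ≤ a) (hb : 0 ≤ b) (hba : b ≤ a)
    (hab : a + b = 1) (n : ℕ) :
    1 / 2 - a ^ n ≤ ∑ j ∈ (Finset.range (n + 1)).filter fun j => 1 ≤ j ∧ 2 * j ≤ n,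
      a ^ (n - j) * b ^ j * n.choose j := by
  set f : ℕ → ℝ := fun j => a ^ (n - j) * b ^ j * n.choose j with hf
  set F : ℕ → ℝ := fun j => if 2 * j ≤ n then f j else 0 with hF
  have hf0 : ∀ j, 0 ≤ f j := fun j => by positivity
  have hF0 : ∀ j, 0 ≤ F j := fun j => by
    simp only [hF]
    split_ifs
    · exact hf0 j
    · exact le_rfl
  have h1 : ∑ j ∈ Finset.range (n + 1), f j = 1 := by
    have h := add_pow b a n
    rw [add_comm b a, hab, one_pow] at h
    rw [h]
    refine Finset.sum_congr rfl fun j _ => ?_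
    simp only [hf]
    ring
  have h2 : ∀ j ∈ Finset.range (n + 1), f j ≤ F j + F (n - j) := by
    intro j hj
    have hjn : j ≤ n := Nat.lt_succ_iff.1 (Finset.mem_range.1 hj)
    by_cases h : 2 * j ≤ n
    · have : F j = f j := if_pos h
      linarith [hF0 (n - j)]
    · have hr : F (n - j) = f (n - j) := if_pos (by omega)
      have : f j ≤ f (n - j) := by
        simp only [hf]
        rw [Nat.choose_symm hjn, Nat.sub_sub_self hjn]
        refine mul_le_mul_of_nonneg_right ?_ (Nat.cast_nonneg _)
        have e1 : b ^ j = b ^ (n - j) * b ^ (2 * j - n) := by rw [← pow_add]; congr 1; omega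
        have e2 : a ^ j = a ^ (n - j) * a ^ (2 * j - n) := by rw [← pow_add]; congr 1; omega
        rw [e1, e2]
        calc a ^ (n - j) * (b ^ (n - j) * b ^ (2 * j - n))
            ≤ a ^ (n - j) * (b ^ (n - j) * a ^ (2 * j - n)) := by gcongr
          _ = _ := by ring
      linarith [hF0 j]
  have h3 : ∑ j ∈ Finset.range (n + 1), F (n - j) = ∑ j ∈ Finset.range (n + 1), F j := by
    have := Finset.sum_range_reflect F (n + 1)
    rw [← this]
    refine Finset.sum_congr rfl fun j _ => ?_
    rw [show n + 1 - 1 - j = n - j by omega]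
  have h4 : 1 ≤ 2 * ∑ j ∈ Finset.range (n + 1), F j := by
    have := Finset.sum_le_sum h2
    rw [Finset.sum_add_distrib, h3, h1] at this
    linarith
  have h5 : ∑ j ∈ Finset.range (n + 1), F j =
      a ^ n + ∑ j ∈ (Finset.range (n + 1)).filter fun j => 1 ≤ j ∧ 2 * j ≤ n, f j := by
    rw [Finset.sum_filter, Finset.sum_range_succ', Finset.sum_range_succ', add_comm]
    simp [hF, hf]
  linarith

theorem half_sub_pow_le_sum_stringError {a b : ℝ} (ha : 0 ≤ a) (hb : 0 ≤ b) (hba : b ≤ a)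
    (hab : a + b = 1) {δ : ℝ} (hδ : 0 ≤ δ) (hδ1 : δ < 1) :
    1 / 2 - a ^ n ≤ ((n + 1) * (2 * n ^ 2 * (2 * n + 1))) *
      ∑ s : Fin n → Fin 2, (a ^ (n - wt s) * b ^ wt s) * stringError n δ s := by
  refine (half_sub_pow_le_sum_choose ha hb hba hab n).trans ?_
  rw [← Finset.sum_fiberwise_of_maps_to (t := Finset.range (n + 1)) (g := wt)
    fun s _ => Finset.mem_range.2 (Nat.lt_succ_iff.2 (wt_le s)), Finset.mul_sum]
  -- Strings are grouped by their number of ones; the groups outside 1 ≤ j ≤ n/2 are discarded,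
  -- being nonnegative.
  refine (Finset.sum_le_sum fun j hj => ?_).trans
    (Finset.sum_le_sum_of_subset_of_nonneg (Finset.filter_subset _ _) fun j _ _ => ?_)
  · obtain ⟨-, h1, h2⟩ := Finset.mem_filter.1 hj
    obtain ⟨i, rfl⟩ := Nat.exists_eq_add_of_le' h1
    have h3 : ∑ s ∈ Finset.univ.filter fun s : Fin n → Fin 2 => wt s = i + 1,
        (a ^ (n - wt s) * b ^ wt s) * stringError n δ s =
        (a ^ (n - (i + 1)) * b ^ (i + 1)) *
          ∑ s ∈ Finset.univ.filter fun s : Fin n → Fin 2 => wt s = i + 1, stringError n δ s := by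
      rw [Finset.mul_sum]
      refine Finset.sum_congr rfl fun s hs => ?_
      rw [(Finset.mem_filter.1 hs).2]
    rw [h3, mul_left_comm]
    exact mul_le_mul_of_nonneg_left (choose_le_sum_stringError hδ hδ1 h2) (by positivity)
  · refine mul_nonneg (by positivity) (Finset.sum_nonneg fun s _ => ?_)
    exact mul_nonneg (by positivity) (stringError_nonneg δ s)

/-! ### The average error -/

theorem injective_of_eq_ketbra {e : OrthonormalBasis (Fin 2) ℂ (Sys 2)}
    {ρ : Fin 2 → DensityOp (Sys 2)} (hρe : ∀ i, (ρ i).1 = ketbra (e i)) :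
    Function.Injective ρ := by
  have h01 : ρ 0 ≠ ρ 1 := by
    intro h
    have h1 : ketbra (e 0) = ketbra (e 1) := by rw [← hρe, ← hρe, h]
    have h2 := congrArg (fun A : Op (Sys 2) => ⟪e 0, A (e 0)⟫_ℂ) h1
    simp [ketbra, e.inner_eq_ite] at h2
  intro i j hij
  fin_cases i <;> fin_cases j
  · rfl
  · exact absurd hij h01
  · exact absurd hij.symm h01
  · rfl

theorem sum_toReal_eq_one {e : OrthonormalBasis (Fin 2) ℂ (Sys 2)} {p : PMF (DensityOp (Sys 2))}
    {ρ : Fin 2 → DensityOp (Sys 2)} (hρe : ∀ i, (ρ i).1 = ketbra (e i))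
    (hsupp : ∀ σ, p σ ≠ 0 → σ ∈ Set.range ρ) :
    (p (ρ 0)).toReal + (p (ρ 1)).toReal = 1 := by
  have h1 : ∑' i, p (ρ i) = 1 := by
    rw [(injective_of_eq_ketbra hρe).tsum_eq fun σ hσ => hsupp σ hσ, p.tsum_coe]
  rw [tsum_fintype, Fin.sum_univ_two] at h1
  rw [← ENNReal.toReal_add (p.apply_ne_top _) (p.apply_ne_top _), h1, ENNReal.toReal_one]

/-- The average error for a source supported on the two states of an orthonormal basis. -/
theorem codeError_eq_sum {e : OrthonormalBasis (Fin 2) ℂ (Sys 2)} {p : PMF (DensityOp (Sys 2))}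
    {ρ : Fin 2 → DensityOp (Sys 2)} (hρe : ∀ i, (ρ i).1 = ketbra (e i))
    (hsupp : ∀ σ, p σ ≠ 0 → σ ∈ Set.range ρ) (n : ℕ) (δ : ℝ) :
    codeError 2 n δ p =
      ∑ s : Fin n → Fin 2, (∏ k, (p (ρ (s k))).toReal) * stringError n δ s := by
  obtain ⟨g, hg, hge⟩ := exists_specialUnitary_ketbra_eq e
  have hinj' : Function.Injective fun s : Fin n → Fin 2 => fun k => ρ (s k) :=
    (injective_of_eq_ketbra hρe).comp_left
  unfold codeError avgError
  rw [← hinj'.tsum_eq, tsum_fintype]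
  · refine Finset.sum_congr rfl fun s _ => ?_
    have h1 : tensorOp (fun k => (ρ (s k)).1) =
        ketbra (tensorRep n g (EuclideanSpace.single s 1)) := by
      rw [← tensorOp_ketbra_eq]
      simp only [hρe, hge]
    simp only [h1]
    rw [tensorRep_single_error δ hg]
  -- A sequence of nonzero probability has every entry in the support, so it comes from a binary
  -- string.
  · intro σ hσ
    have h1 : ∀ k, σ k ∈ Set.range ρ := by
      intro k
      refine hsupp _ fun h0 => hσ ?_
      simp only
      rw [Finset.prod_eq_zero (Finset.mem_univ k) (by rw [h0, ENNReal.toReal_zero]), zero_mul]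
    choose s hs using h1
    exact ⟨s, funext hs⟩

theorem codeError_bounds (e : OrthonormalBasis (Fin 2) ℂ (Sys 2)) (p : PMF (DensityOp (Sys 2)))
    (hp : (fun ρ : DensityOp (Sys 2) => ρ.1) '' p.support = {ketbra (e 0), ketbra (e 1)}) :
    ∃ a : ℝ, 0 < a ∧ a < 1 ∧ ∀ (n : ℕ) (δ : ℝ), 0 ≤ δ → δ < 1 →
      codeError 2 n δ p ≤ 3 * n + 1 ∧
      1 / 2 - a ^ n ≤ ((n + 1) * (2 * n ^ 2 * (2 * n + 1))) * codeError 2 n δ p := by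
  have hex : ∀ i, ∃ ρ ∈ p.support, ρ.1 = ketbra (e i) := by
    intro i
    have : ketbra (e i) ∈ (fun ρ : DensityOp (Sys 2) => ρ.1) '' p.support := by
      rw [hp]
      fin_cases i <;> simp
    exact this
  choose ρ hρ hρe using hex
  have hsupp : ∀ σ, p σ ≠ 0 → σ ∈ Set.range ρ := by
    intro σ hσ
    have h1 : σ.1 ∈ (fun ρ : DensityOp (Sys 2) => ρ.1) '' p.support :=
      ⟨σ, (PMF.mem_support_iff p σ).2 hσ, rfl⟩
    rw [hp] at h1
    rcases h1 with h | h
    · exact ⟨0, Subtype.ext ((hρe 0).trans h.symm)⟩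
    · exact ⟨1, Subtype.ext ((hρe 1).trans (Set.mem_singleton_iff.1 h).symm)⟩
  -- The likelier state is made state 0, relabelling the basis by a swap if necessary.
  have key : ∃ w : Fin 2 → ℝ, w 1 ≤ w 0 ∧ (∀ i, 0 < w i) ∧ w 0 + w 1 = 1 ∧ ∀ (n : ℕ) (δ : ℝ),
      codeError 2 n δ p = ∑ s : Fin n → Fin 2, (∏ k, w (s k)) * stringError n δ s := by
    have hpos : ∀ i, 0 < (p (ρ i)).toReal := fun i =>
      ENNReal.toReal_pos ((PMF.mem_support_iff p _).1 (hρ i)) (p.apply_ne_top _)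
    rcases le_total (p (ρ 1)).toReal (p (ρ 0)).toReal with h | h
    · exact ⟨fun i => (p (ρ i)).toReal, h, hpos, sum_toReal_eq_one hρe hsupp,
        codeError_eq_sum hρe hsupp⟩
    · have hρe' : ∀ i, (ρ (Equiv.swap 0 1 i)).1 = ketbra ((e.reindex (Equiv.swap 0 1)) i) := by
        intro i
        rw [OrthonormalBasis.reindex_apply, Equiv.symm_swap, hρe]
      have hsupp' : ∀ σ, p σ ≠ 0 → σ ∈ Set.range fun i => ρ (Equiv.swap 0 1 i) := by
        intro σ hσ
        obtain ⟨i, hi⟩ := hsupp σ hσ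
        exact ⟨Equiv.swap 0 1 i, by simpa using hi⟩
      exact ⟨fun i => (p (ρ (Equiv.swap 0 1 i))).toReal, by simpa using h, fun i => hpos _,
        sum_toReal_eq_one hρe' hsupp', codeError_eq_sum hρe' hsupp'⟩
  obtain ⟨w, hw, hpos, hsum, herr⟩ := key
  refine ⟨w 0, hpos 0, by linarith [hpos 1], fun n δ hδ hδ1 => ⟨?_, ?_⟩⟩
  · rw [herr]
    have h1 : ∑ s : Fin n → Fin 2, ∏ k, w (s k) = 1 := by
      have := Finset.prod_univ_sum (fun _ : Fin n => (Finset.univ : Finset (Fin 2)))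
        fun _ i => w i
      rw [Fintype.piFinset_univ] at this
      rw [← this]
      simp [Fin.sum_univ_two, hsum]
    calc _ ≤ ∑ s : Fin n → Fin 2, (∏ k, w (s k)) * (3 * n + 1 : ℝ) :=
          Finset.sum_le_sum fun s _ => mul_le_mul_of_nonneg_left (stringError_le hδ hδ1 s)
            (Finset.prod_nonneg fun k _ => (hpos _).le)
      _ = 3 * n + 1 := by rw [← Finset.sum_mul, h1, one_mul]
  · rw [herr]
    simp only [prod_comp_eq_pow_wt]
    exact half_sub_pow_le_sum_stringError (hpos 0).le (hpos 1).le hw hsum hδ hδ1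

end Qubit

end QCode

end

/-! ### Polynomial bounds give a vanishing exponent -/

theorem mainTheorem5
    (e : OrthonormalBasis (Fin 2) ℂ (QCode.Sys 2))
    (p : PMF (QCode.DensityOp (QCode.Sys 2)))
    (hp : (fun ρ : QCode.DensityOp (QCode.Sys 2) => ρ.1) '' p.support =
      {QCode.ketbra (e 0), QCode.ketbra (e 1)})
    (δ : ℕ → ℝ) (hδ_nonneg : ∀ n, 0 ≤ δ n) (hδ : ∀ n, |δ n| < 1) :
    (∀ᶠ n : ℕ in Filter.atTop, 0 < QCode.codeError 2 n (δ n) p) ∧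
      Filter.Tendsto (fun n : ℕ => -1 / (n : ℝ) * Real.log (QCode.codeError 2 n (δ n) p))
        Filter.atTop (nhds 0) := by
  obtain ⟨a, ha0, ha1, hbound⟩ := QCode.codeError_bounds e p hp
  set ε : ℕ → ℝ := fun n => QCode.codeError 2 n (δ n) p with hε
  have hup : ∀ n, ε n ≤ 3 * n + 1 := fun n =>
    (hbound n (δ n) (hδ_nonneg n) ((le_abs_self _).trans_lt (hδ n))).1
  have hlow : ∀ᶠ n : ℕ in Filter.atTop, 1 ≤ (n : ℝ) ^ 5 * ε n := by
    have h1 : ∀ᶠ n : ℕ in Filter.atTop, a ^ n < 1 / 4 :=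
      (tendsto_pow_atTop_nhds_zero_of_lt_one ha0.le ha1).eventually_lt_const (by norm_num)
    -- Four times the quartic prefactor is at most 48n⁴, which n ≥ 48 absorbs into n⁵.
    filter_upwards [h1, Filter.eventually_ge_atTop 48] with n hn hn48
    have h2 := (hbound n (δ n) (hδ_nonneg n) ((le_abs_self _).trans_lt (hδ n))).2
    have h3 : (48 : ℝ) ≤ n := by exact_mod_cast hn48
    have h4 : 1 / 4 ≤ ((n + 1) * (2 * n ^ 2 * (2 * n + 1))) * ε n := by
      change _ ≤ _ * QCode.codeError 2 n (δ n) p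
      linarith
    have h5 : 0 < ε n := by
      by_contra! hle
      have : ((n + 1) * (2 * n ^ 2 * (2 * n + 1)) : ℝ) * ε n ≤ 0 :=
        mul_nonpos_of_nonneg_of_nonpos (by positivity) hle
      linarith
    have h6 : 4 * ((n + 1) * (2 * n ^ 2 * (2 * n + 1)) : ℝ) ≤ (n : ℝ) ^ 5 := by
      calc 4 * ((n + 1) * (2 * n ^ 2 * (2 * n + 1)) : ℝ)
          ≤ 4 * ((n + n) * (2 * n ^ 2 * (2 * n + n))) := by gcongr <;> linarith
        _ = 48 * (n : ℝ) ^ 4 := by ring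
        _ ≤ n * (n : ℝ) ^ 4 := by gcongr
        _ = (n : ℝ) ^ 5 := by ring
    have h7 := mul_le_mul_of_nonneg_right h6 h5.le
    linarith
  have hpos : ∀ᶠ n : ℕ in Filter.atTop, 0 < ε n := by
    filter_upwards [hlow] with n hn
    by_contra! hle
    linarith [mul_nonpos_of_nonneg_of_nonpos (by positivity : (0 : ℝ) ≤ (n : ℝ) ^ 5) hle]
  refine ⟨hpos, ?_⟩
  have hlog : Filter.Tendsto (fun n : ℕ => 5 * (Real.log n / n)) Filter.atTop (nhds 0) := by
    have h := (Real.isLittleO_log_id_atTop.tendsto_div_nhds_zero).comp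
      (tendsto_natCast_atTop_atTop (R := ℝ))
    simpa using h.const_mul 5
  refine squeeze_zero_norm' ?_ hlog
  -- From n = 4 on, 3n + 1 ≤ n².
  filter_upwards [hlow, hpos, Filter.eventually_ge_atTop 4] with n hn hn0 hn4
  have h4 : (4 : ℝ) ≤ n := by exact_mod_cast hn4
  have hn1 : (0 : ℝ) < n := by linarith
  have hL : 0 ≤ Real.log n := Real.log_nonneg (by linarith)
  have hl1 : Real.log (ε n) ≤ 5 * Real.log n := by
    have h1 : ε n ≤ (n : ℝ) ^ 2 := (hup n).trans (by nlinarith)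
    have h2 := Real.log_le_log hn0 h1
    rw [Real.log_pow] at h2
    push_cast at h2
    linarith
  have hl2 : -(5 * Real.log n) ≤ Real.log (ε n) := by
    have h1 := Real.log_nonneg hn
    rw [Real.log_mul (by positivity) hn0.ne', Real.log_pow] at h1
    push_cast at h1
    linarith
  rw [norm_mul, norm_div, norm_neg, norm_one, Real.norm_of_nonneg hn1.le, Real.norm_eq_abs]
  calc 1 / (n : ℝ) * |Real.log (ε n)| ≤ 1 / n * (5 * Real.log n) := by
        gcongr
        exact abs_le.2 ⟨hl2, hl1⟩
    _ = 5 * (Real.log n / n) := by ring
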